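/- Let $k$ be a field. Let $\Sigma$ be the groupoid whose objects are the natural numbers $n\ge 0$ and whose only morphisms are the permutations $\Sigma(n,n)=\Sigma_n$, composed so that a functor $M\colon\Sigma\to \mathit{Vect}_k$ is a sequence of right $\Sigma_n$-modules $M(n)$. For a small category $C$, let $\mathbb S C$ be the free symmetric monoidal category on $C$: objects are finite lists $(c_1\cdots c_n)$ of objects of $C$, and a morphism $(c_1\cdots c_n)\to(d_1\cdots d_n)$ is a permutation $\sigma\in\Sigma_n$ with morphisms $f_i\colon c_i\to d_{\sigma(i)}$. A (non-unital, symmetric) $C$-operad is a functor $P\colon(\mathbb S C)^{op}\times C\to\mathit{Vect}_k$ with bilinear partial compositions $$\circ_i\colon P(c_1\cdots c_n;c)\otimes P(d_1\cdots d_m;c_i)\to P(c_1\cdots c_{i-1}\,d_1\cdots d_m\,c_{i+1}\cdots c_n;c),\qquad 1\le i\le n,$$ which are natural in the remaining inputs and the output, form a cowedge in the connecting object $c_i\in C$, are equivariant, $\circ_i\cdot((-)\sigma\otimes(-)\tau)=(-)(\sigma\circ_i\tau)\cdot\circ_{\sigma(i)}$ (where $\sigma\circ_i\tau$ inserts $\tau$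 at the $i$-th place of $\sigma$), and are sequentially and parallelly associative. A $P$-algebra is a functor $A\colon C\to\mathit{Vect}_k$ with a morphism of $C$-operads from $P$ to the endomorphism operad $\mathit{End}_A(c_1\cdots c_n;c)=\mathrm{Hom}(A(c_1)\otimes\cdots\otimes A(c_n),A(c))$; morphisms of $P$-algebras are natural transformations compatible with all operations. A $C$-operad is binary quadratic if it is isomorphic to $F(X)/(S)$, where $F(X)$ is the free $C$-operad on a family $X$ of functors $X_n\colon (C^{op})^n\times C\to\mathit{Vect}_k$ with $X_n=0$ for $n\ne2$, and $(S)$ is the operadic ideal generated by a set $S$ of operations that are linear combinations of trees with two vertices. Let $X_2(n\;m;n+m-1)$, for $n\ge1$, $m\ge0$, be freely spanned by the symbols $(*_i,\sigma\,\tau;\pi)$ with $1\le i\le n$, $\sigma\in\Sigma_n$, $\tau\in\Sigma_m$, $\pi\in\Sigma_{n+m-1}$, on which $\Sigma$ acts by $X_2(\sigma'\,\tau';\pi')(*_i,\sigma\,\tau;\pi)=(*_i,\sigma\sigma'\,\tau\tau';\pi'\pi)$ (composites in $\Sigma$); let $X_2$ be zero on all other colors, and $X_j=0$ for $j\ne2$.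 Let $Q$ be the quotient of $X$ by the equivalence relation (of functors) generated by $(*_i,\sigma\,\tau;1)\sim(*_{\sigma(i)},1\,1;\sigma\circ_i\tau)$, and let $[*_i]\in Q(n\;m;n+m-1)$ be the class of $(*_i,1\,1;1)$. Let $\mathit{As}$ be the operadic ideal of the free $\Sigma$-operad $F(Q)$ generated by the associators $$[*_i]\circ_1[*_j]-\tau\big([*_{j+l-1}]\circ_1[*_i]\big)\ \ (1\le i<j\le n),\qquad [*_i]\circ_1[*_j]-[*_j]\circ_2[*_{i-j+1}]\ \ (j\le i<j+m),$$ $$[*_i]\circ_1[*_j]-\tau\big([*_j]\circ_1[*_{i-m+1}]\big)\ \ (j+m\le i\le n+m-1),$$ in $F(Q)(n\;m\;l;n+m+l-2)$, for all $n\ge 1$, $1\le j\le n$, $m,l\ge0$, where $\tau$ transposes the second and the third input. Put $\mathbb H=F(Q)/\mathit{As}$. **Theorem.** The $\Sigma$-operad $\mathbb H$ is binary quadratic, and its category of algebras in $\mathit{Vect}_k$ is isomorphic to the category of classical symmetric non-unital Markl operads in $\mathit{Vect}_k$, i.e. of sequences $M$ of right $\Sigma_n$-modules $M(n)$, $n\ge0$,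 with equivariant, sequentially and parallelly associative partial compositions $\circ_i\colon M(n)\otimes M(m)\to M(n+m-1)$, $1\le i\le n$. The isomorphism is the identity on underlying functors $\Sigma\to\mathit{Vect}_k$ and on their morphisms, and takes an algebra $(M,\alpha)$ to the operad $M$ with $\circ_i=\alpha([*_i])$. -/

import Mathlib

open CategoryTheory Opposite

universe w w₁ w₂ v v₁ u₁ u

namespace CatOperad

noncomputable section

/-! ### Positions of inputs after inserting `m` inputs in place of the `i`-th of `n` inputs -/

/-- The position, after `m` inputs were inserted at the `i`-th place of `n` inputs, of an old
input `p ≠ i`. -/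
def outer {n : ℕ} (m : ℕ) (i p : Fin n) (h : p ≠ i) : Fin (n + m - 1) :=
  ⟨if p.1 < i.1 then p.1 else p.1 + m - 1, by
    have : p.1 ≠ i.1 := fun e => h (Fin.ext e)
    split_ifs <;> omega⟩

/-- The position, after `m` inputs were inserted at the `i`-th place of `n` inputs, of the
`q`-th inserted input. -/
def inner {n m : ℕ} (i : Fin n) (q : Fin m) : Fin (n + m - 1) := ⟨i.1 + q.1, by omega⟩

theorem outer_val {n : ℕ} (m : ℕ) (i p : Fin n) (h : p ≠ i) :
    (outer m i p h).1 = if p.1 < i.1 then p.1 else p.1 + m - 1 := rfl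

theorem inner_val {n m : ℕ} (i : Fin n) (q : Fin m) : (inner i q).1 = i.1 + q.1 := rfl

/-- The inputs after the insertion are the old inputs except the `i`-th, and the new ones. -/
def spliceEquiv {n : ℕ} (m : ℕ) (i : Fin n) :
    {p : Fin n // p ≠ i} ⊕ Fin m ≃ Fin (n + m - 1) where
  toFun := Sum.elim (fun p => outer m i p.1 p.2) (inner i)
  invFun r :=
    if h₁ : r.1 < i.1 then
      Sum.inl ⟨⟨r.1, by omega⟩, fun e => by have := congrArg Fin.val e; simp at this; omega⟩
    else if h₂ : r.1 < i.1 + m then Sum.inr ⟨r.1 - i.1, by omega⟩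
    else Sum.inl ⟨⟨r.1 + 1 - m, by omega⟩,
      fun e => by have := congrArg Fin.val e; simp at this; omega⟩
  left_inv := by
    rintro (⟨p, hp⟩ | q)
    · have hp' : p.1 ≠ i.1 := fun e => hp (Fin.ext e)
      by_cases h : p.1 < i.1
      · simp only [Sum.elim_inl, outer_val, h, if_true, dite_true]
      · have h₁ : ¬ (p.1 + m - 1 < i.1) := by omega
        have h₂ : ¬ (p.1 + m - 1 < i.1 + m) := by omega
        simp only [Sum.elim_inl, outer_val, h, if_false, h₁, h₂, dite_false]
        congr 2
        apply Fin.ext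
        show p.1 + m - 1 + 1 - m = p.1
        omega
    · have h₁ : ¬ (i.1 + q.1 < i.1) := by omega
      simp [inner]
  right_inv := by
    intro r
    by_cases h₁ : r.1 < i.1
    · simp only [h₁, dite_true, Sum.elim_inl]
      apply Fin.ext
      rw [outer_val]
      simp only [h₁, if_true]
    · by_cases h₂ : r.1 < i.1 + m
      · simp only [h₁, h₂, dite_true, dite_false, Sum.elim_inr]
        apply Fin.ext
        simp only [inner_val]
        omega
      · simp only [h₁, h₂, dite_false, Sum.elim_inl]
        apply Fin.ext
        rw [outer_val]
        simp only
        split_ifs <;> omega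

theorem spliceEquiv_inl {n : ℕ} (m : ℕ) (i : Fin n) (p : {p : Fin n // p ≠ i}) :
    spliceEquiv m i (Sum.inl p) = outer m i p.1 p.2 := rfl

theorem spliceEquiv_inr {n m : ℕ} (i : Fin n) (q : Fin m) :
    spliceEquiv m i (Sum.inr q) = inner i q := rfl

theorem spliceEquiv_symm_outer {n : ℕ} (m : ℕ) (i p : Fin n) (h : p ≠ i) :
    (spliceEquiv m i).symm (outer m i p h) = Sum.inl ⟨p, h⟩ := by
  rw [Equiv.symm_apply_eq]; rfl

theorem spliceEquiv_symm_inner {n m : ℕ} (i : Fin n) (q : Fin m) :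
    (spliceEquiv m i).symm (inner i q) = Sum.inr q := by
  rw [Equiv.symm_apply_eq]; rfl

theorem splice_cases {n m : ℕ} (i : Fin n) (r : Fin (n + m - 1)) :
    (∃ p, ∃ h : p ≠ i, r = outer m i p h) ∨ ∃ q, r = inner i q := by
  obtain ⟨s, rfl⟩ := (spliceEquiv m i).surjective r
  rcases s with ⟨p, h⟩ | q
  · exact Or.inl ⟨p, h, rfl⟩
  · exact Or.inr ⟨q, rfl⟩

theorem outer_injective {n : ℕ} {m : ℕ} {i p p' : Fin n} {h : p ≠ i} {h' : p' ≠ i}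
    (e : outer m i p h = outer m i p' h') : p = p' := by
  have := (spliceEquiv m i).injective (a₁ := Sum.inl ⟨p, h⟩) (a₂ := Sum.inl ⟨p', h'⟩) e
  simpa using this

theorem outer_ne {n : ℕ} (m : ℕ) {i p p' : Fin n} (h : p ≠ i) (h' : p' ≠ i) (hp : p ≠ p') :
    outer m i p h ≠ outer m i p' h' := fun e => hp (outer_injective e)

theorem inner_injective {n m : ℕ} {i : Fin n} {q q' : Fin m}
    (e : inner i q = inner i q') : q = q' := by
  have := (spliceEquiv m i).injective (a₁ := Sum.inr q) (a₂ := Sum.inr q') e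
  simpa using this

theorem inner_ne_outer {n m : ℕ} {i p : Fin n} (q : Fin m) (h : p ≠ i) :
    inner i q ≠ outer m i p h := fun e => by
  have := (spliceEquiv m i).injective (a₁ := Sum.inr q) (a₂ := Sum.inl ⟨p, h⟩) e
  simp at this

/-- The permutation `σ ∘ᵢ τ`, given by inserting the permutation `τ` at the `i`-th place of `σ`:
the `i`-th block goes to the place `σ i` and is permuted by `τ`. (Permutations are written as
bijections `Fin n ≃ Fin n'`, which forces `n = n'`.) -/
def insertPerm {n n' m m' : ℕ} (σ : Fin n ≃ Fin n') (i : Fin n) (τ : Fin m ≃ Fin m') :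
    Fin (n + m - 1) ≃ Fin (n' + m' - 1) :=
  ((spliceEquiv m i).symm.trans
    (Equiv.sumCongr (σ.subtypeEquiv fun _ => (not_congr σ.apply_eq_iff_eq).symm) τ)).trans
    (spliceEquiv m' (σ i))

theorem insertPerm_outer {n n' m m' : ℕ} (σ : Fin n ≃ Fin n') (i : Fin n) (τ : Fin m ≃ Fin m')
    (p : Fin n) (h : p ≠ i) :
    insertPerm σ i τ (outer m i p h) = outer m' (σ i) (σ p) (fun e => h (σ.injective e)) := by
  simp [insertPerm, spliceEquiv_symm_outer, spliceEquiv_inl]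

theorem insertPerm_inner {n n' m m' : ℕ} (σ : Fin n ≃ Fin n') (i : Fin n) (τ : Fin m ≃ Fin m')
    (q : Fin m) : insertPerm σ i τ (inner i q) = inner (σ i) (τ q) := by
  simp [insertPerm, spliceEquiv_symm_inner, spliceEquiv_inr]

theorem par_len {n : ℕ} (m l : ℕ) (j p : Fin n) (h : p ≠ j) :
    n + m - 1 + l - 1 = n + l - 1 + m - 1 := by
  have : p.1 ≠ j.1 := fun e => h (Fin.ext e)
  have := p.2
  have := j.2
  omega

theorem seq_len {n m : ℕ} (l : ℕ) (j : Fin n) (q : Fin m) :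
    n + m - 1 + l - 1 = n + (m + l - 1) - 1 := by
  have := j.2
  have := q.2
  omega

theorem cast_par_outer {n m l : ℕ} {j p r : Fin n} (h : p ≠ j) (hr : r ≠ j) (hr' : r ≠ p) :
    Fin.cast (par_len m l j p h)
      (outer l (outer m j p h) (outer m j r hr) (outer_ne m hr h hr')) =
    outer m (outer l p j h.symm) (outer l p r hr') (outer_ne l hr' h.symm hr) := by
  have h₁ : p.1 ≠ j.1 := fun e => h (Fin.ext e)
  have h₂ : r.1 ≠ j.1 := fun e => hr (Fin.ext e)
  have h₃ : r.1 ≠ p.1 := fun e => hr' (Fin.ext e)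
  apply Fin.ext
  simp only [Fin.val_cast, outer_val]
  split_ifs <;> omega

theorem cast_par_left {n m l : ℕ} {j p : Fin n} (h : p ≠ j) (q : Fin m) :
    Fin.cast (par_len m l j p h)
      (outer l (outer m j p h) (inner j q) (inner_ne_outer q h)) =
    inner (outer l p j h.symm) q := by
  have h₁ : p.1 ≠ j.1 := fun e => h (Fin.ext e)
  apply Fin.ext
  simp only [Fin.val_cast, outer_val, inner_val]
  split_ifs <;> omega

theorem cast_par_right {n m l : ℕ} {j p : Fin n} (h : p ≠ j) (q : Fin l) :
    Fin.cast (par_len m l j p h) (inner (outer m j p h) q) =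
    outer m (outer l p j h.symm) (inner p q) (inner_ne_outer q h.symm) := by
  have h₁ : p.1 ≠ j.1 := fun e => h (Fin.ext e)
  apply Fin.ext
  simp only [Fin.val_cast, outer_val, inner_val]
  split_ifs <;> omega

theorem cast_seq_outer {n m l : ℕ} {j r : Fin n} (q : Fin m) (hr : r ≠ j) :
    Fin.cast (seq_len l j q)
      (outer l (inner j q) (outer m j r hr) (inner_ne_outer q hr).symm) =
    outer (m + l - 1) j r hr := by
  have h₂ : r.1 ≠ j.1 := fun e => hr (Fin.ext e)
  apply Fin.ext
  simp only [Fin.val_cast, outer_val, inner_val]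
  split_ifs <;> omega

theorem cast_seq_mid {n m l : ℕ} {j : Fin n} {q s : Fin m} (hs : s ≠ q) :
    Fin.cast (seq_len l j q)
      (outer l (inner j q) (inner j s) (fun e => hs (inner_injective e))) =
    inner j (outer l q s hs) := by
  have h₂ : s.1 ≠ q.1 := fun e => hs (Fin.ext e)
  apply Fin.ext
  by_cases h₃ : s.1 < q.1
  · have h₄ : j.1 + s.1 < j.1 + q.1 := by omega
    simp only [Fin.val_cast, outer_val, inner_val, h₃, h₄, if_true]
  · have h₄ : ¬ (j.1 + s.1 < j.1 + q.1) := by omega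
    simp only [Fin.val_cast, outer_val, inner_val, h₃, h₄, if_false]
    omega

theorem cast_seq_inner {n m l : ℕ} {j : Fin n} (q : Fin m) (t : Fin l) :
    Fin.cast (seq_len l j q) (inner (inner j q) t) = inner j (inner q t) := by
  apply Fin.ext
  simp only [Fin.val_cast, inner_val]
  omega

/-! ### Lists of objects: the free symmetric monoidal category -/

/-- Objects of the free symmetric monoidal category on `C`: finite lists of objects of `C`. -/
@[ext]
structure SymList (C : Type u₁) where
  /-- the length of the list -/
  len : ℕ
  /-- the entries of the list -/
  obj : Fin len → C

namespace SymList

/-- A morphism of lists `(c₁ … cₙ) ⟶ (d₁ … dₙ)` is a permutation `σ` with morphisms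
`cᵢ ⟶ d_{σ(i)}`. (A bijection `Fin n ≃ Fin m` exists only for `n = m`.) -/
@[ext]
structure Hom {C : Type u₁} [Category.{v₁} C] (L M : SymList C) where
  /-- the permutation -/
  perm : Fin L.len ≃ Fin M.len
  /-- the morphisms of `C` -/
  hom : ∀ i, L.obj i ⟶ M.obj (perm i)

instance {C : Type u₁} [Category.{v₁} C] : Category (SymList C) where
  Hom L M := Hom L M
  id L := ⟨Equiv.refl _, fun i => 𝟙 (L.obj i)⟩
  comp f g := ⟨f.perm.trans g.perm, fun i => f.hom i ≫ g.hom (f.perm i)⟩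
  id_comp f := by
    refine Hom.ext rfl (heq_of_eq (funext fun i => ?_))
    exact Category.id_comp _
  comp_id f := by
    refine Hom.ext rfl (heq_of_eq (funext fun i => ?_))
    exact Category.comp_id _
  assoc f g h := by
    refine Hom.ext rfl (heq_of_eq (funext fun i => ?_))
    exact Category.assoc _ _ _

theorem hom_ext {C : Type u₁} [Category.{v₁} C] {L M : SymList C} {f g : L ⟶ M} (hp : ∀ i, f.perm i = g.perm i)
    (hh : ∀ i, f.hom i ≫ eqToHom (congrArg M.obj (hp i)) = g.hom i) : f = g := by
  obtain ⟨p, h⟩ := f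
  obtain ⟨p', h'⟩ := g
  obtain rfl : p = p' := Equiv.ext hp
  congr 1
  funext i
  simpa using hh i

@[simp] theorem id_perm {C : Type u₁} [Category.{v₁} C] (L : SymList C) : Hom.perm (𝟙 L) = Equiv.refl _ := rfl
@[simp] theorem id_hom {C : Type u₁} [Category.{v₁} C] (L : SymList C) (i : Fin L.len) : Hom.hom (𝟙 L) i = 𝟙 _ := rfl
@[simp] theorem comp_perm {C : Type u₁} [Category.{v₁} C] {L M N : SymList C}
    (f : L ⟶ M) (g : M ⟶ N) :
    Hom.perm (f ≫ g) = f.perm.trans g.perm := rfl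
@[simp] theorem comp_hom {C : Type u₁} [Category.{v₁} C] {L M N : SymList C}
    (f : L ⟶ M) (g : M ⟶ N) (i : Fin L.len) :
    Hom.hom (f ≫ g) i = f.hom i ≫ g.hom (f.perm i) := rfl

/-- The morphism of lists given by a family of morphisms and the identity permutation. -/
def ofPi {C : Type u₁} [Category.{v₁} C] {n : ℕ} {c d : Fin n → C} (f : c ⟶ d) : (⟨n, c⟩ : SymList C) ⟶ ⟨n, d⟩ :=
  ⟨Equiv.refl _, f⟩

/-- The identification of two equal lists, as a morphism. -/
def castHom {C : Type u₁} [Category.{v₁} C] {L M : SymList C} (hn : L.len = M.len) (h : ∀ i, L.obj i = M.obj (Fin.cast hn i)) :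
    L ⟶ M :=
  ⟨finCongr hn, fun i => eqToHom (h i)⟩

/-- The list `(c₁ … c_{i-1} d₁ … d_m c_{i+1} … cₙ)`. -/
abbrev splice {C : Type u₁} (L : SymList C) (i : Fin L.len) (M : SymList C) : SymList C where
  len := L.len + M.len - 1
  obj r := Sum.elim (fun p => L.obj p.1) M.obj ((spliceEquiv M.len i).symm r)

theorem splice_outer {C : Type u₁} (L : SymList C) (i : Fin L.len) (M : SymList C) (p : Fin L.len)
    (h : p ≠ i) : (L.splice i M).obj (outer M.len i p h) = L.obj p := by
  simp [spliceEquiv_symm_outer]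

theorem splice_inner {C : Type u₁} (L : SymList C) (i : Fin L.len) (M : SymList C) (q : Fin M.len) :
    (L.splice i M).obj (inner i q) = M.obj q := by
  simp [spliceEquiv_symm_inner]

/-- The sum of two families of morphisms. -/
def spliceHomAux {C : Type u₁} [Category.{v₁} C] {L L' M M' : SymList C} (φ : L' ⟶ L) (i : Fin L'.len) (ψ : M' ⟶ M) :
    ∀ s : {p : Fin L'.len // p ≠ i} ⊕ Fin M'.len,
      (Sum.elim (fun p => L'.obj p.1) M'.obj s : C) ⟶
      Sum.elim (fun p : {p : Fin L.len // p ≠ φ.perm i} => L.obj p.1) M.obj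
        (Equiv.sumCongr (φ.perm.subtypeEquiv fun _ =>
          (not_congr φ.perm.apply_eq_iff_eq).symm) ψ.perm s)
  | Sum.inl p => φ.hom p.1
  | Sum.inr q => ψ.hom q

/-- The morphism `(σ ∘ᵢ τ, f₁ … g₁ … g_m … fₙ)`, without `fᵢ`, obtained from
`φ = (σ, f₁ … fₙ)` and `ψ = (τ, g₁ … g_m)`. -/
def spliceHom {C : Type u₁} [Category.{v₁} C] {L L' M M' : SymList C} (φ : L' ⟶ L) (i : Fin L'.len) (ψ : M' ⟶ M) :
    L'.splice i M' ⟶ L.splice (φ.perm i) M where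
  perm := insertPerm φ.perm i ψ.perm
  hom r := spliceHomAux φ i ψ ((spliceEquiv M'.len i).symm r) ≫ eqToHom (by
    show Sum.elim _ _ _ = Sum.elim _ _ ((spliceEquiv M.len (φ.perm i)).symm
      (spliceEquiv M.len (φ.perm i) _))
    rw [Equiv.symm_apply_apply]
    rfl)

theorem spliceHom_hom_outer {C : Type u₁} [Category.{v₁} C] {L L' M M' : SymList C} (φ : L' ⟶ L) (i : Fin L'.len) (ψ : M' ⟶ M)
    (p : Fin L'.len) (h : p ≠ i) :
    (spliceHom φ i ψ).hom (outer M'.len i p h) =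
      eqToHom (L'.splice_outer i M' p h) ≫ φ.hom p ≫ eqToHom (by
        have e := insertPerm_outer φ.perm i ψ.perm p h
        exact ((congrArg (L.splice (φ.perm i) M).obj e).trans (splice_outer _ _ _ _ _)).symm) := by
  have key : ∀ (s : {p : Fin L'.len // p ≠ i} ⊕ Fin M'.len) (hs : s = Sum.inl ⟨p, h⟩)
      {Z : C} (hZ : _ = Z), spliceHomAux φ i ψ s ≫ eqToHom hZ =
        eqToHom (by rw [hs]; rfl) ≫ φ.hom p ≫ eqToHom (by rw [← hZ, hs]; rfl) := by
    rintro s rfl Z rfl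
    exact (Category.id_comp _).symm
  exact key _ (spliceEquiv_symm_outer _ _ _ _) _

theorem spliceHom_hom_inner {C : Type u₁} [Category.{v₁} C] {L L' M M' : SymList C} (φ : L' ⟶ L) (i : Fin L'.len) (ψ : M' ⟶ M)
    (q : Fin M'.len) :
    (spliceHom φ i ψ).hom (inner i q) =
      eqToHom (L'.splice_inner i M' q) ≫ ψ.hom q ≫ eqToHom (by
        have e := insertPerm_inner φ.perm i ψ.perm q
        exact ((congrArg (L.splice (φ.perm i) M).obj e).trans (splice_inner _ _ _ _)).symm) := by
  have key : ∀ (s : {p : Fin L'.len // p ≠ i} ⊕ Fin M'.len) (hs : s = Sum.inr q)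
      {Z : C} (hZ : _ = Z), spliceHomAux φ i ψ s ≫ eqToHom hZ =
        eqToHom (by rw [hs]; rfl) ≫ ψ.hom q ≫ eqToHom (by rw [← hZ, hs]; rfl) := by
    rintro s rfl Z rfl
    exact (Category.id_comp _).symm
  exact key _ (spliceEquiv_symm_inner _ _) _

theorem par_obj {C : Type u₁} (L M N : SymList C) (j p : Fin L.len) (h : p ≠ j)
    (r : Fin ((L.splice j M).splice (outer M.len j p h) N).len) :
    ((L.splice j M).splice (outer M.len j p h) N).obj r =
      ((L.splice p N).splice (outer N.len p j h.symm) M).obj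
        (Fin.cast (par_len M.len N.len j p h) r) := by
  rcases splice_cases (outer M.len j p h) r with ⟨r, hr, rfl⟩ | ⟨t, rfl⟩
  · rcases splice_cases j r with ⟨r, hr', rfl⟩ | ⟨s, rfl⟩
    · have hrp : r ≠ p := by rintro rfl; exact hr rfl
      exact ((splice_outer _ _ _ _ _).trans (splice_outer _ _ _ _ _)).trans
        ((congrArg _ (cast_par_outer h hr' hrp)).trans
          ((splice_outer _ _ _ _ _).trans (splice_outer _ _ _ _ _))).symm
    · exact ((splice_outer _ _ _ _ _).trans (splice_inner _ _ _ _)).trans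
        ((congrArg _ (cast_par_left h s)).trans (splice_inner _ _ _ _)).symm
  · exact (splice_inner _ _ _ _).trans
      ((congrArg _ (cast_par_right h t)).trans
        ((splice_outer _ _ _ _ _).trans (splice_inner _ _ _ _))).symm

theorem seq_obj {C : Type u₁} (L M N : SymList C) (j : Fin L.len) (q : Fin M.len)
    (r : Fin ((L.splice j M).splice (inner j q) N).len) :
    ((L.splice j M).splice (inner j q) N).obj r =
      (L.splice j (M.splice q N)).obj (Fin.cast (seq_len N.len j q) r) := by
  rcases splice_cases (inner j q) r with ⟨r, hr, rfl⟩ | ⟨t, rfl⟩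
  · rcases splice_cases j r with ⟨r, hr', rfl⟩ | ⟨s, rfl⟩
    · exact ((splice_outer _ _ _ _ _).trans (splice_outer _ _ _ _ _)).trans
        ((congrArg _ (cast_seq_outer q hr')).trans (splice_outer _ _ (M.splice q N) _ _)).symm
    · have hs : s ≠ q := by rintro rfl; exact hr rfl
      exact ((splice_outer _ _ _ _ _).trans (splice_inner _ _ _ _)).trans
        ((congrArg _ (cast_seq_mid hs)).trans
          ((splice_inner _ _ (M.splice q N) _).trans (splice_outer _ _ _ _ _))).symm
  · exact (splice_inner _ _ _ _).trans
      ((congrArg _ (cast_seq_inner q t)).trans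
        ((splice_inner _ _ (M.splice q N) _).trans (splice_inner _ _ _ _))).symm

/-- The lists of inputs of `(x ∘ⱼ y) ∘ z` and `(x ∘ₚ z) ∘ y`, where `y` and `z` are plugged into
different inputs `j` and `p` of `x`, are equal. -/
def parHom {C : Type u₁} [Category.{v₁} C] (L M N : SymList C) (j p : Fin L.len) (h : p ≠ j) :
    (L.splice j M).splice (outer M.len j p h) N ⟶
      (L.splice p N).splice (outer N.len p j h.symm) M :=
  castHom (par_len M.len N.len j p h) (par_obj L M N j p h)

/-- The lists of inputs of `(x ∘ⱼ y) ∘ z` and `x ∘ⱼ (y ∘_q z)` are equal. -/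
def seqHom {C : Type u₁} [Category.{v₁} C] (L M N : SymList C) (j : Fin L.len) (q : Fin M.len) :
    (L.splice j M).splice (inner j q) N ⟶ L.splice j (M.splice q N) :=
  castHom (seq_len N.len j q) (seq_obj L M N j q)

end SymList

/-! ### Operads colored by a category -/

/-- A `C`-collection of `k`-vector spaces: a functor `(𝕊 C)ᵒᵖ × C ⥤ Vect`, where `𝕊 C` is the
free symmetric monoidal category on `C`. -/
abbrev Coll (k : Type u) [Field k] (C : Type u₁) [Category.{v₁} C] :=
  (SymList C)ᵒᵖ × C ⥤ ModuleCat.{w} k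

namespace Coll

/-- The space of operations with the given inputs and output. -/
abbrev sp {k : Type u} [Field k] {C : Type u₁} [Category.{v₁} C] (P : Coll.{w} k C)
    (L : SymList C) (c : C) : ModuleCat.{w} k :=
  P.obj (op L, c)

/-- The action of a morphism of `(𝕊 C)ᵒᵖ × C` on operations. -/
def act {k : Type u} [Field k] {C : Type u₁} [Category.{v₁} C] (P : Coll.{w} k C)
    {L L' : SymList C} {c c' : C} (φ : L' ⟶ L) (f : c ⟶ c') : P.sp L c →ₗ[k] P.sp L' c' :=
  (P.map (X := (op L, c)) (Y := (op L', c')) (Prod.mkHom φ.op f)).hom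

theorem act_id {k : Type u} [Field k] {C : Type u₁} [Category.{v₁} C] (P : Coll.{w} k C)
    {L : SymList C} {c : C} (x : P.sp L c) : P.act (𝟙 L) (𝟙 c) x = x := by
  have := P.map_id (op L, c)
  exact congrArg (fun g => g.hom x) this

theorem act_act {k : Type u} [Field k] {C : Type u₁} [Category.{v₁} C] (P : Coll.{w} k C)
    {L L' L'' : SymList C} {c c' c'' : C} (φ : L' ⟶ L) (f : c ⟶ c') (ψ : L'' ⟶ L')
    (g : c' ⟶ c'') (x : P.sp L c) : P.act ψ g (P.act φ f x) = P.act (ψ ≫ φ) (f ≫ g) x := by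
  have := P.map_comp (X := (op L, c)) (Y := (op L', c')) (Z := (op L'', c''))
    (Prod.mkHom φ.op f) (Prod.mkHom ψ.op g)
  exact (congrArg (fun g => g.hom x) this).symm

/-- A collection from its spaces of operations and the actions on them. -/
def mk' {k : Type u} [Field k] {C : Type u₁} [Category.{v₁} C]
    (V : SymList C → C → Type w) [∀ L c, AddCommGroup (V L c)] [∀ L c, Module k (V L c)]
    (a : ∀ {L L' : SymList C} {c c' : C}, (L' ⟶ L) → (c ⟶ c') → (V L c →ₗ[k] V L' c'))
    (a_id : ∀ (L : SymList C) (c : C) (x : V L c), a (𝟙 L) (𝟙 c) x = x)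
    (a_comp : ∀ {L L' L'' : SymList C} {c c' c'' : C} (φ : L' ⟶ L) (f : c ⟶ c')
      (ψ : L'' ⟶ L') (g : c' ⟶ c'') (x : V L c), a (ψ ≫ φ) (f ≫ g) x = a ψ g (a φ f x)) :
    Coll.{w} k C where
  obj X := ModuleCat.of k (V X.1.unop X.2)
  map g := ModuleCat.ofHom (a g.1.unop g.2)
  map_id X := by
    ext x
    exact a_id _ _ x
  map_comp f g := by
    ext x
    exact a_comp f.1.unop f.2 g.1.unop g.2 x

end Coll

/-- A (non-unital, symmetric) `C`-operad in `k`-vector spaces.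

The composition `∘ᵢ` is a map out of the coend `Pₙ ⊗ᵢ P_m`, i.e. a family of bilinear maps indexed
by the connecting object of `C`, here the `i`-th entry of the list `L`. The axiom `comp_map`
says at once that this family is natural in the remaining inputs and the output, that it is a
cowedge in the connecting object, and that it is equivariant:
`∘ᵢ · ((-)σ ⊗ (-)τ) = (-)(σ ∘ᵢ τ) · ∘_{σ(i)}`. -/
structure COperad (k : Type u) [Field k] (C : Type u₁) [Category.{v₁} C] where
  /-- the underlying collection -/
  coll : Coll.{w} k C
  /-- the partial compositions -/
  comp : ∀ {L M : SymList C} {c : C} (i : Fin L.len),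
    coll.sp L c →ₗ[k] coll.sp M (L.obj i) →ₗ[k] coll.sp (L.splice i M) c
  comp_map : ∀ {L L' M M' : SymList C} {c c' : C} (φ : L' ⟶ L) (f : c ⟶ c') (ψ : M' ⟶ M)
    (i : Fin L'.len) (x : coll.sp L c) (y : coll.sp M (L'.obj i)),
    comp i (coll.act φ f x) (coll.act ψ (𝟙 _) y) =
      coll.act (SymList.spliceHom φ i ψ) f (comp (φ.perm i) x (coll.act (𝟙 M) (φ.hom i) y))
  /-- parallel associativity: plugging `y` and `z` into different inputs `j` and `p` of `x` -/
  par_assoc : ∀ {L M N : SymList C} {c : C} (j p : Fin L.len) (h : p ≠ j) (x : coll.sp L c)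
    (y : coll.sp M (L.obj j)) (z : coll.sp N (L.obj p)),
    comp (outer M.len j p h) (comp j x y)
        (coll.act (𝟙 N) (eqToHom (L.splice_outer j M p h).symm) z) =
      coll.act (SymList.parHom L M N j p h) (𝟙 c)
        (comp (outer N.len p j h.symm) (comp p x z)
          (coll.act (𝟙 M) (eqToHom (L.splice_outer p N j h.symm).symm) y))
  /-- sequential associativity: plugging `z` into the input `q` of `y`, which is plugged into the
  input `j` of `x` -/
  seq_assoc : ∀ {L M N : SymList C} {c : C} (j : Fin L.len) (q : Fin M.len) (x : coll.sp L c)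
    (y : coll.sp M (L.obj j)) (z : coll.sp N (M.obj q)),
    comp (inner j q) (comp j x y)
        (coll.act (𝟙 N) (eqToHom (L.splice_inner j M q).symm) z) =
      coll.act (SymList.seqHom L M N j q) (𝟙 c) (comp j x (comp q y z))

/-- A morphism of `C`-operads (possibly with values in different universes). -/
@[ext]
structure COperad.Hom {k : Type u} [Field k] {C : Type u₁} [Category.{v₁} C]
    (P : COperad.{w₁} k C) (R : COperad.{w₂} k C) where
  /-- the underlying linear maps -/
  app : ∀ (L : SymList C) (c : C), P.coll.sp L c →ₗ[k] R.coll.sp L c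
  app_act : ∀ {L L' : SymList C} {c c' : C} (φ : L' ⟶ L) (f : c ⟶ c') (x : P.coll.sp L c),
    app L' c' (P.coll.act φ f x) = R.coll.act φ f (app L c x)
  app_comp : ∀ {L M : SymList C} {c : C} (i : Fin L.len) (x : P.coll.sp L c)
    (y : P.coll.sp M (L.obj i)),
    app (L.splice i M) c (P.comp i x y) = R.comp i (app L c x) (app M (L.obj i) y)

/-! ### The endomorphism operad -/

namespace EndOp

/-- The action of a morphism of `C` on the values of a functor. -/
def ev {k : Type u} [Field k] {C : Type u₁} [Category.{v₁} C] (A : C ⥤ ModuleCat.{v} k)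
    {c d : C} (f : c ⟶ d) : A.obj c →ₗ[k] A.obj d := (A.map f).hom

section
variable {k : Type u} [Field k] {C : Type u₁} [Category.{v₁} C] (A : C ⥤ ModuleCat.{v} k)

theorem ev_id {c : C} (x : A.obj c) : ev A (𝟙 c) x = x := by simp [ev]

theorem ev_ev {c d e : C} (f : c ⟶ d) (g : d ⟶ e) (x : A.obj c) :
    ev A g (ev A f x) = ev A (f ≫ g) x := by simp [ev]

theorem ev_index {ι : Type*} {o : ι → C} (x : ∀ i, A.obj (o i)) {i j : ι} (h : i = j)
    {d : C} (f : o j ⟶ d) (g : o i ⟶ d) (hg : g = eqToHom (congrArg o h) ≫ f) :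
    ev A g (x i) = ev A f (x j) := by
  subst h; subst hg; simp

/-- `(x₁, …, xₙ)` moved along a morphism of lists `(σ, f₁ … fₙ)`: the entry at the place `σ(i)`
is `fᵢ xᵢ`. -/
def moveArg {L L' : SymList C} (φ : L' ⟶ L) (x : ∀ j, A.obj (L'.obj j)) (q : Fin L.len) :
    A.obj (L.obj q) :=
  ev A (φ.hom (φ.perm.symm q) ≫ eqToHom (congrArg L.obj (φ.perm.apply_symm_apply q)))
    (x (φ.perm.symm q))

theorem moveArg_perm {L L' : SymList C} (φ : L' ⟶ L) (x : ∀ j, A.obj (L'.obj j))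
    (j : Fin L'.len) : moveArg A φ x (φ.perm j) = ev A (φ.hom j) (x j) := by
  have key : ∀ (j' : Fin L'.len) (h : j' = j) (e : L.obj (φ.perm j') = L.obj (φ.perm j)),
      ev A (φ.hom j' ≫ eqToHom e) (x j') = ev A (φ.hom j) (x j) := by
    rintro _ rfl e
    simp
  exact key _ (φ.perm.symm_apply_apply j) _

theorem moveArg_eq {L L' : SymList C} (φ : L' ⟶ L) (x : ∀ j, A.obj (L'.obj j))
    (y : ∀ q, A.obj (L.obj q)) (h : ∀ j, y (φ.perm j) = ev A (φ.hom j) (x j)) :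
    moveArg A φ x = y := by
  funext q
  obtain ⟨j, rfl⟩ := φ.perm.surjective q
  rw [moveArg_perm, h]

theorem moveArg_update [∀ n, DecidableEq (Fin n)] {L L' : SymList C} (φ : L' ⟶ L)
    (x : ∀ j, A.obj (L'.obj j)) (j : Fin L'.len) (a : A.obj (L'.obj j)) :
    moveArg A φ (Function.update x j a) =
      Function.update (moveArg A φ x) (φ.perm j) (ev A (φ.hom j) a) := by
  apply moveArg_eq
  intro j'
  by_cases h : j' = j
  · subst h; simp
  · have h' : φ.perm j' ≠ φ.perm j := fun e => h (φ.perm.injective e)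
    rw [Function.update_of_ne h', Function.update_of_ne h, moveArg_perm]

/-- The entries plugged into the inner operation. -/
def innerArg {L : SymList C} (i : Fin L.len) (M : SymList C)
    (x : ∀ r, A.obj ((L.splice i M).obj r)) (q : Fin M.len) : A.obj (M.obj q) :=
  ev A (eqToHom (L.splice_inner i M q)) (x (inner i q))

/-- The entries plugged into the outer operation; the `i`-th one is `a`. -/
def outerArg {L : SymList C} (i : Fin L.len) (M : SymList C)
    (x : ∀ r, A.obj ((L.splice i M).obj r)) (a : A.obj (L.obj i)) (p : Fin L.len) :
    A.obj (L.obj p) :=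
  if h : p = i then ev A (eqToHom (congrArg L.obj h.symm)) a
  else ev A (eqToHom (L.splice_outer i M p h)) (x (outer M.len i p h))

theorem outerArg_self {L : SymList C} (i : Fin L.len) (M : SymList C)
    (x : ∀ r, A.obj ((L.splice i M).obj r)) (a : A.obj (L.obj i)) :
    outerArg A i M x a i = a := by
  simp [outerArg, ev_id]

theorem outerArg_ne {L : SymList C} (i : Fin L.len) (M : SymList C)
    (x : ∀ r, A.obj ((L.splice i M).obj r)) (a : A.obj (L.obj i)) {p : Fin L.len} (h : p ≠ i) :
    outerArg A i M x a p = ev A (eqToHom (L.splice_outer i M p h)) (x (outer M.len i p h)) := by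
  simp [outerArg, h]

theorem outerArg_eq {L : SymList C} (i : Fin L.len) (M : SymList C)
    (x : ∀ r, A.obj ((L.splice i M).obj r)) (a : A.obj (L.obj i)) (y : ∀ p, A.obj (L.obj p))
    (h : y i = a) (h' : ∀ p (hp : p ≠ i),
      y p = ev A (eqToHom (L.splice_outer i M p hp)) (x (outer M.len i p hp))) :
    outerArg A i M x a = y := by
  funext p
  by_cases hp : p = i
  · subst hp; rw [outerArg_self, h]
  · rw [outerArg_ne A i M x a hp, h' p hp]

theorem innerArg_update_inner [∀ n, DecidableEq (Fin n)] {L : SymList C} (i : Fin L.len)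
    (M : SymList C) (x : ∀ r, A.obj ((L.splice i M).obj r)) (q : Fin M.len)
    (b : A.obj ((L.splice i M).obj (inner i q))) :
    innerArg A i M (Function.update x (inner i q) b) =
      Function.update (innerArg A i M x) q (ev A (eqToHom (L.splice_inner i M q)) b) := by
  funext q'
  by_cases h : q' = q
  · subst h
    rw [Function.update_self, innerArg]
    erw [Function.update_self]
  · have h' : inner i q' ≠ inner i q := fun e => h (inner_injective e)
    rw [Function.update_of_ne h, innerArg]
    erw [Function.update_of_ne h']
    rfl

theorem innerArg_update_outer [∀ n, DecidableEq (Fin n)] {L : SymList C} (i : Fin L.len)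
    (M : SymList C) (x : ∀ r, A.obj ((L.splice i M).obj r)) (p : Fin L.len) (hp : p ≠ i)
    (b : A.obj ((L.splice i M).obj (outer M.len i p hp))) :
    innerArg A i M (Function.update x (outer M.len i p hp) b) = innerArg A i M x := by
  funext q'
  rw [innerArg]
  erw [Function.update_of_ne (inner_ne_outer q' hp)]
  rfl

theorem outerArg_update_outer [∀ n, DecidableEq (Fin n)] {L : SymList C} (i : Fin L.len)
    (M : SymList C) (x : ∀ r, A.obj ((L.splice i M).obj r)) (a : A.obj (L.obj i))
    (p : Fin L.len) (hp : p ≠ i) (b : A.obj ((L.splice i M).obj (outer M.len i p hp))) :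
    outerArg A i M (Function.update x (outer M.len i p hp) b) a =
      Function.update (outerArg A i M x a) p (ev A (eqToHom (L.splice_outer i M p hp)) b) := by
  apply outerArg_eq
  · rw [Function.update_of_ne hp.symm, outerArg_self]
  · intro p' hp'
    by_cases h : p' = p
    · subst h
      rw [Function.update_self]
      erw [Function.update_self]
    · have h' : outer M.len i p' hp' ≠ outer M.len i p hp := outer_ne _ _ _ h
      rw [Function.update_of_ne h, outerArg_ne A i M x a hp']
      erw [Function.update_of_ne h']

theorem outerArg_update_inner [∀ n, DecidableEq (Fin n)] {L : SymList C} (i : Fin L.len)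
    (M : SymList C) (x : ∀ r, A.obj ((L.splice i M).obj r)) (a a' : A.obj (L.obj i))
    (q : Fin M.len) (b : A.obj ((L.splice i M).obj (inner i q))) :
    outerArg A i M (Function.update x (inner i q) b) a' =
      Function.update (outerArg A i M x a) i a' := by
  apply outerArg_eq
  · simp
  · intro p' hp'
    rw [Function.update_of_ne hp', outerArg_ne A i M x a hp']
    erw [Function.update_of_ne (inner_ne_outer q hp').symm]

theorem outerArg_change [∀ n, DecidableEq (Fin n)] {L : SymList C} (i : Fin L.len)
    (M : SymList C) (x : ∀ r, A.obj ((L.splice i M).obj r)) (a a' : A.obj (L.obj i)) :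
    outerArg A i M x a' = Function.update (outerArg A i M x a) i a' := by
  apply outerArg_eq
  · simp
  · intro p' hp'
    rw [Function.update_of_ne hp', outerArg_ne A i M x a hp']

/-- The space `Hom(A(c₁) ⊗ ⋯ ⊗ A(cₙ), A(c))`, as multilinear maps. -/
abbrev Sp (L : SymList C) (c : C) : Type v :=
  MultilinearMap k (fun j : Fin L.len => A.obj (L.obj j)) (A.obj c)

/-- The action of a morphism of `(𝕊 C)ᵒᵖ × C`. -/
def actOne {L L' : SymList C} {c c' : C} (φ : L' ⟶ L) (f : c ⟶ c') (F : Sp A L c) :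
    Sp A L' c' where
  toFun x := ev A f (F (moveArg A φ x))
  map_update_add' x j a b := by
    classical
    have : ‹DecidableEq (Fin L'.len)› = fun a b => instDecidableEqFin L'.len a b :=
      Subsingleton.elim _ _
    subst this
    have := moveArg_update A φ x j
    simp only [this, map_add, MultilinearMap.map_update_add]
  map_update_smul' x j a b := by
    classical
    have : ‹DecidableEq (Fin L'.len)› = fun a b => instDecidableEqFin L'.len a b :=
      Subsingleton.elim _ _
    subst this
    have := moveArg_update A φ x j
    simp only [this, map_smul, MultilinearMap.map_update_smul]

/-- The action of a morphism of `(𝕊 C)ᵒᵖ × C`, as a linear map. -/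
def act {L L' : SymList C} {c c' : C} (φ : L' ⟶ L) (f : c ⟶ c') : Sp A L c →ₗ[k] Sp A L' c' where
  toFun := actOne A φ f
  map_add' F G := by ext x; simp [actOne]
  map_smul' a F := by ext x; simp [actOne]

theorem act_apply {L L' : SymList C} {c c' : C} (φ : L' ⟶ L) (f : c ⟶ c') (F : Sp A L c)
    (x : ∀ j, A.obj (L'.obj j)) : act A φ f F x = ev A f (F (moveArg A φ x)) := rfl

/-- The composition `F ∘ᵢ G = F(1 ⊗ ⋯ ⊗ G ⊗ ⋯ ⊗ 1)`. -/
def compOne {L M : SymList C} {c : C} (i : Fin L.len) (F : Sp A L c) (G : Sp A M (L.obj i)) :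
    Sp A (L.splice i M) c where
  toFun x := F (outerArg A i M x (G (innerArg A i M x)))
  map_update_add' x r a b := by
    classical
    have : ‹DecidableEq (Fin (L.splice i M).len)› =
        fun a b => instDecidableEqFin (L.splice i M).len a b := Subsingleton.elim _ _
    subst this
    rcases splice_cases i r with ⟨p, hp, rfl⟩ | ⟨q, rfl⟩
    · have h₁ := innerArg_update_outer A i M x p hp
      have h₂ := fun a => outerArg_update_outer A i M x a p hp
      simp only [h₁, h₂, map_add, MultilinearMap.map_update_add]
    · have h₁ := innerArg_update_inner A i M x q
      have h₂ := fun a' => outerArg_update_inner A i M x (G (innerArg A i M x)) a' q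
      simp only [h₁, h₂, map_add, MultilinearMap.map_update_add]
  map_update_smul' x r a b := by
    classical
    have : ‹DecidableEq (Fin (L.splice i M).len)› =
        fun a b => instDecidableEqFin (L.splice i M).len a b := Subsingleton.elim _ _
    subst this
    rcases splice_cases i r with ⟨p, hp, rfl⟩ | ⟨q, rfl⟩
    · have h₁ := innerArg_update_outer A i M x p hp
      have h₂ := fun a => outerArg_update_outer A i M x a p hp
      simp only [h₁, h₂, map_smul, MultilinearMap.map_update_smul]
    · have h₁ := innerArg_update_inner A i M x q
      have h₂ := fun a' => outerArg_update_inner A i M x (G (innerArg A i M x)) a' q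
      simp only [h₁, h₂, map_smul, MultilinearMap.map_update_smul]

/-- The composition as a bilinear map. -/
def comp {L M : SymList C} {c : C} (i : Fin L.len) :
    Sp A L c →ₗ[k] Sp A M (L.obj i) →ₗ[k] Sp A (L.splice i M) c :=
  LinearMap.mk₂ k (compOne A i)
    (fun F F' G => by ext x; simp [compOne])
    (fun a F G => by ext x; simp [compOne])
    (fun F G G' => by
      classical
      ext x
      have h := fun a' => outerArg_change A i M x 0 a'
      simp only [compOne, MultilinearMap.coe_mk, add_apply]
      rw [h, h (G _), h (G' _), MultilinearMap.map_update_add])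
    (fun a F G => by
      classical
      ext x
      have h := fun a' => outerArg_change A i M x 0 a'
      simp only [compOne, MultilinearMap.coe_mk, smul_apply]
      rw [h, h (G _), MultilinearMap.map_update_smul])

theorem comp_apply {L M : SymList C} {c : C} (i : Fin L.len) (F : Sp A L c)
    (G : Sp A M (L.obj i)) (x : ∀ r, A.obj ((L.splice i M).obj r)) :
    comp A i F G x = F (outerArg A i M x (G (innerArg A i M x))) := rfl

theorem moveArg_id {L : SymList C} (x : ∀ j, A.obj (L.obj j)) : moveArg A (𝟙 L) x = x :=
  moveArg_eq A (𝟙 L) x x fun j => (ev_id A (x j)).symm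

theorem moveArg_comp {L L' L'' : SymList C} (ψ : L'' ⟶ L') (φ : L' ⟶ L)
    (x : ∀ j, A.obj (L''.obj j)) : moveArg A (ψ ≫ φ) x = moveArg A φ (moveArg A ψ x) := by
  apply moveArg_eq
  intro j
  exact (moveArg_perm A φ (moveArg A ψ x) (ψ.perm j)).trans
    ((congrArg _ (moveArg_perm A ψ x j)).trans (ev_ev A _ _ _))

theorem comp_eqToHom_aux {a b d e : C} (h₁ : a = b) (f : b ⟶ d) (h₂ : d = e) (h₃ : e = d) :
    (eqToHom h₁ ≫ f ≫ eqToHom h₂) ≫ eqToHom h₃ = eqToHom h₁ ≫ f := by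
  subst h₁ h₂
  simp

theorem innerArg_spliceHom {L L' M M' : SymList C} (φ : L' ⟶ L) (i : Fin L'.len) (ψ : M' ⟶ M)
    (x : ∀ r, A.obj ((L'.splice i M').obj r)) :
    innerArg A (φ.perm i) M (moveArg A (SymList.spliceHom φ i ψ) x) =
      moveArg A ψ (innerArg A i M' x) := by
  symm
  apply moveArg_eq
  intro s
  have e : (SymList.spliceHom φ i ψ).perm (inner i s) = inner (φ.perm i) (ψ.perm s) :=
    insertPerm_inner φ.perm i ψ.perm s
  have h₁ := moveArg_perm A (SymList.spliceHom φ i ψ) x (inner i s)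
  have h₂ := ev_index A (moveArg A (SymList.spliceHom φ i ψ) x) e
    (eqToHom (L.splice_inner (φ.perm i) M (ψ.perm s))) (eqToHom ((congrArg _ e).trans (L.splice_inner (φ.perm i) M (ψ.perm s))))
    (eqToHom_trans _ _).symm
  rw [h₁, SymList.spliceHom_hom_inner] at h₂
  rw [innerArg, ← h₂, innerArg, ev_ev, ev_ev]
  exact congrArg (fun g => ev A g (x (inner i s))) (comp_eqToHom_aux _ _ _ _)

theorem outerArg_spliceHom {L L' M M' : SymList C} (φ : L' ⟶ L) (i : Fin L'.len) (ψ : M' ⟶ M)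
    (x : ∀ r, A.obj ((L'.splice i M').obj r)) (a : A.obj (L'.obj i)) :
    outerArg A (φ.perm i) M (moveArg A (SymList.spliceHom φ i ψ) x) (ev A (φ.hom i) a) =
      moveArg A φ (outerArg A i M' x a) := by
  symm
  apply moveArg_eq
  intro s
  by_cases hs : s = i
  · subst hs
    rw [outerArg_self, outerArg_self]
  · have hs' : φ.perm s ≠ φ.perm i := fun e => hs (φ.perm.injective e)
    have e : (SymList.spliceHom φ i ψ).perm (outer M'.len i s hs) =
        outer M.len (φ.perm i) (φ.perm s) hs' := insertPerm_outer φ.perm i ψ.perm s hs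
    have h₁ := moveArg_perm A (SymList.spliceHom φ i ψ) x (outer M'.len i s hs)
    have h₂ := ev_index A (moveArg A (SymList.spliceHom φ i ψ) x) e
      (eqToHom (L.splice_outer (φ.perm i) M (φ.perm s) hs'))
      (eqToHom ((congrArg _ e).trans (L.splice_outer (φ.perm i) M (φ.perm s) hs')))
      (eqToHom_trans _ _).symm
    rw [h₁, SymList.spliceHom_hom_outer] at h₂
    rw [outerArg_ne A _ _ _ _ hs', outerArg_ne A _ _ _ _ hs, ← h₂, ev_ev, ev_ev]
    exact congrArg (fun g => ev A g (x (outer M'.len i s hs))) (comp_eqToHom_aux _ _ _ _)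

theorem moveArg_castHom {L L' : SymList C} (hn : L'.len = L.len)
    (h : ∀ i, L'.obj i = L.obj (Fin.cast hn i)) (x : ∀ j, A.obj (L'.obj j)) (i : Fin L'.len)
    (q : Fin L.len) (hq : Fin.cast hn i = q) :
    moveArg A (SymList.castHom hn h) x q =
      ev A (eqToHom ((h i).trans (congrArg L.obj hq))) (x i) := by
  subst hq
  exact moveArg_perm A (SymList.castHom hn h) x i

theorem ev_cast {a b d : C} (h : a = b) (h' : b = d) (z : A.obj a) :
    ev A (eqToHom h') (ev A (eqToHom h) z) = ev A (eqToHom (h.trans h')) z := by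
  rw [ev_ev, eqToHom_trans]

theorem ev_cast_self {a : C} (h : a = a) (z : A.obj a) : ev A (eqToHom h) z = z := by
  rw [eqToHom_refl, ev_id]

theorem comp_map {L L' M M' : SymList C} {c c' : C} (φ : L' ⟶ L) (f : c ⟶ c') (ψ : M' ⟶ M)
    (i : Fin L'.len) (F : Sp A L c) (G : Sp A M (L'.obj i)) :
    comp A i (act A φ f F) (act A ψ (𝟙 _) G) =
      act A (SymList.spliceHom φ i ψ) f
        (comp A (φ.perm i) F (act A (𝟙 M) (φ.hom i) G)) := by
  ext x
  rw [comp_apply, act_apply, act_apply, act_apply, comp_apply, act_apply, moveArg_id, ev_id,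
    innerArg_spliceHom, outerArg_spliceHom]

theorem par_assoc {L M N : SymList C} {c : C} (j p : Fin L.len) (h : p ≠ j) (F : Sp A L c)
    (G : Sp A M (L.obj j)) (H : Sp A N (L.obj p)) :
    comp A (outer M.len j p h) (comp A j F G)
        (act A (𝟙 N) (eqToHom (L.splice_outer j M p h).symm) H) =
      act A (SymList.parHom L M N j p h) (𝟙 c)
        (comp A (outer N.len p j h.symm) (comp A p F H)
          (act A (𝟙 M) (eqToHom (L.splice_outer p N j h.symm).symm) G)) := by
  ext x
  rw [comp_apply, comp_apply, act_apply, act_apply, comp_apply, comp_apply, act_apply,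
    moveArg_id, moveArg_id, ev_id]
  have hy := moveArg_castHom A (par_len M.len N.len j p h) (SymList.par_obj L M N j p h) x
  change ∀ i q hq, moveArg A (SymList.parHom L M N j p h) x q = _ at hy
  generalize moveArg A (SymList.parHom L M N j p h) x = y at hy
  congr 1
  apply outerArg_eq
  · rw [outerArg_ne A _ _ _ _ h.symm, outerArg_self, ev_cast, ev_cast_self]
    congr 1
    funext s
    rw [innerArg, innerArg, outerArg_ne A _ _ _ _ (inner_ne_outer s h),
      hy _ _ (cast_par_left h s), ev_cast, ev_cast]
  · intro r hr
    by_cases hrp : r = p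
    · subst hrp
      rw [outerArg_self, outerArg_self, ev_cast, ev_cast_self]
      congr 1
      funext s
      rw [innerArg, innerArg, outerArg_ne A _ _ _ _ (inner_ne_outer s h.symm),
        hy _ _ (cast_par_right h s), ev_cast, ev_cast]
    · rw [outerArg_ne A _ _ _ _ hrp, outerArg_ne A _ _ _ _ (outer_ne _ hrp h.symm hr),
        outerArg_ne A _ _ _ _ (outer_ne _ hr h hrp), hy _ _ (cast_par_outer h hr hrp),
        ev_cast, ev_cast, ev_cast]

theorem seq_assoc {L M N : SymList C} {c : C} (j : Fin L.len) (q : Fin M.len) (F : Sp A L c)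
    (G : Sp A M (L.obj j)) (H : Sp A N (M.obj q)) :
    comp A (inner j q) (comp A j F G)
        (act A (𝟙 N) (eqToHom (L.splice_inner j M q).symm) H) =
      act A (SymList.seqHom L M N j q) (𝟙 c) (comp A j F (comp A q G H)) := by
  ext x
  rw [comp_apply, comp_apply, act_apply, act_apply, comp_apply, comp_apply, moveArg_id, ev_id]
  have hy := moveArg_castHom A (seq_len N.len j q) (SymList.seq_obj L M N j q) x
  change ∀ i q' hq, moveArg A (SymList.seqHom L M N j q) x q' = _ at hy
  generalize moveArg A (SymList.seqHom L M N j q) x = y at hy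
  congr 1
  apply outerArg_eq
  · rw [outerArg_self]
    congr 1
    apply outerArg_eq
    · rw [innerArg, outerArg_self, ev_cast, ev_cast_self]
      congr 1
      funext s
      rw [innerArg, innerArg, innerArg, hy _ _ (cast_seq_inner q s), ev_cast, ev_cast]
    · intro s hs
      rw [innerArg, innerArg,
        outerArg_ne A _ _ _ _ (fun e => hs (inner_injective e)),
        hy _ _ (cast_seq_mid hs), ev_cast, ev_cast, ev_cast]
  · intro r hr
    rw [outerArg_ne A _ _ _ _ hr, outerArg_ne A _ _ _ _ (inner_ne_outer q hr).symm,
      hy _ _ (cast_seq_outer q hr), ev_cast, ev_cast]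

end
end EndOp

/-- The underlying collection of the endomorphism operad. -/
def endColl {k : Type u} [Field k] {C : Type u₁} [Category.{v₁} C] (A : C ⥤ ModuleCat.{v} k) :
    Coll.{v} k C :=
  Coll.mk' (EndOp.Sp A) (EndOp.act A)
    (fun L c F => by
      ext x
      rw [EndOp.act_apply, EndOp.moveArg_id, EndOp.ev_id])
    (fun φ f ψ g F => by
      ext x
      rw [EndOp.act_apply, EndOp.act_apply, EndOp.act_apply, EndOp.moveArg_comp, EndOp.ev_ev])

theorem endColl_act {k : Type u} [Field k] {C : Type u₁} [Category.{v₁} C]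
    (A : C ⥤ ModuleCat.{v} k) {L L' : SymList C} {c c' : C} (φ : L' ⟶ L) (f : c ⟶ c') :
    (endColl A).act φ f = EndOp.act A φ f := rfl

/-- The endomorphism `C`-operad of a functor `A`: the operations of type
`(c₁ … cₙ; c)` are the linear maps `A(c₁) ⊗ ⋯ ⊗ A(cₙ) → A(c)`. -/
def endOperad {k : Type u} [Field k] {C : Type u₁} [Category.{v₁} C] (A : C ⥤ ModuleCat.{v} k) :
    COperad.{v} k C where
  coll := endColl A
  comp i := EndOp.comp A i
  comp_map φ f ψ i F G := by
    simp only [endColl_act]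
    exact EndOp.comp_map A φ f ψ i F G
  par_assoc j p h F G H := by
    simp only [endColl_act]
    exact EndOp.par_assoc A j p h F G H
  seq_assoc j q F G H := by
    simp only [endColl_act]
    exact EndOp.seq_assoc A j q F G H

/-! ### Algebras -/

/-- An algebra of a `C`-operad `P`: a functor `A` with a morphism of operads from `P` to the
endomorphism operad of `A`. -/
structure COperad.Algebra {k : Type u} [Field k] {C : Type u₁} [Category.{v₁} C]
    (P : COperad.{w} k C) where
  /-- the underlying functor -/
  obj : C ⥤ ModuleCat.{v} k
  /-- the structure morphism -/
  str : COperad.Hom P (endOperad obj)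

namespace COperad.Algebra

/-- The multilinear map by which an operation acts on an algebra. -/
def eval {k : Type u} [Field k] {C : Type u₁} [Category.{v₁} C] {P : COperad.{w} k C}
    (A : Algebra.{w, v} P) {L : SymList C} {c : C} (x : P.coll.sp L c) :
    MultilinearMap k (fun j : Fin L.len => A.obj.obj (L.obj j)) (A.obj.obj c) :=
  A.str.app L c x

/-- A morphism of algebras: a natural transformation compatible with all operations. -/
@[ext]
structure Hom {k : Type u} [Field k] {C : Type u₁} [Category.{v₁} C] {P : COperad.{w} k C}
    (A B : Algebra.{w, v} P) where
  /-- the underlying natural transformation -/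
  nat : A.obj ⟶ B.obj
  nat_eval : ∀ {L : SymList C} {c : C} (x : P.coll.sp L c) (a : ∀ j, A.obj.obj (L.obj j)),
    (nat.app c).hom (A.eval x a) = B.eval x fun j => (nat.app (L.obj j)).hom (a j)

instance {k : Type u} [Field k] {C : Type u₁} [Category.{v₁} C] {P : COperad.{w} k C} :
    Category (Algebra.{w, v} P) where
  Hom A B := Hom A B
  id A := ⟨𝟙 A.obj, fun x a => by simp⟩
  comp f g := ⟨f.nat ≫ g.nat, fun x a => by simp [f.nat_eval, g.nat_eval]⟩

/-- The functor from algebras to functors. -/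
def forget {k : Type u} [Field k] {C : Type u₁} [Category.{v₁} C] (P : COperad.{w} k C) :
    Algebra.{w, v} P ⥤ (C ⥤ ModuleCat.{v} k) where
  obj A := A.obj
  map f := f.nat

end COperad.Algebra

/-! ### Operadic ideals and quotients -/

/-- The bilinear map induced on quotients. -/
def quotBilin {k : Type u} [Field k] {V : Type w₁} {W : Type w₂} {U : Type w}
    [AddCommGroup V] [Module k V] [AddCommGroup W] [Module k W] [AddCommGroup U] [Module k U]
    (p : Submodule k V) (q : Submodule k W) (r : Submodule k U) (B : V →ₗ[k] W →ₗ[k] U)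
    (hp : ∀ x ∈ p, ∀ y, B x y ∈ r) (hq : ∀ x, ∀ y ∈ q, B x y ∈ r) :
    V ⧸ p →ₗ[k] W ⧸ q →ₗ[k] U ⧸ r :=
  p.liftQ
    { toFun := fun x => q.mapQ r (B x) (hq x)
      map_add' := fun x x' => by
        refine LinearMap.ext fun y => ?_
        induction y using Submodule.Quotient.induction_on
        simp
      map_smul' := fun a x => by
        refine LinearMap.ext fun y => ?_
        induction y using Submodule.Quotient.induction_on
        simp }
    (fun x hx => by
      refine LinearMap.ext fun y => ?_
      induction y using Submodule.Quotient.induction_on with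
      | H y => exact (Submodule.Quotient.mk_eq_zero r).2 (hp x hx y))

theorem quotBilin_mk {k : Type u} [Field k] {V : Type w₁} {W : Type w₂} {U : Type w}
    [AddCommGroup V] [Module k V] [AddCommGroup W] [Module k W] [AddCommGroup U] [Module k U]
    (p : Submodule k V) (q : Submodule k W) (r : Submodule k U) (B : V →ₗ[k] W →ₗ[k] U)
    (hp : ∀ x ∈ p, ∀ y, B x y ∈ r) (hq : ∀ x, ∀ y ∈ q, B x y ∈ r) (x : V) (y : W) :
    quotBilin p q r B hp hq (Submodule.Quotient.mk x) (Submodule.Quotient.mk y) =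
      Submodule.Quotient.mk (B x y) := rfl

/-- An operadic ideal: a subfunctor of the underlying collection such that every composition of
two operations, at least one of which is in the ideal, is in the ideal. -/
structure COperad.Ideal {k : Type u} [Field k] {C : Type u₁} [Category.{v₁} C]
    (P : COperad.{w} k C) where
  /-- the operations in the ideal -/
  carrier : ∀ (L : SymList C) (c : C), Submodule k (P.coll.sp L c)
  act_mem : ∀ {L L' : SymList C} {c c' : C} (φ : L' ⟶ L) (f : c ⟶ c') (x : P.coll.sp L c),
    x ∈ carrier L c → P.coll.act φ f x ∈ carrier L' c'
  comp_mem_left : ∀ {L M : SymList C} {c : C} (i : Fin L.len) (x : P.coll.sp L c)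
    (y : P.coll.sp M (L.obj i)), x ∈ carrier L c → P.comp i x y ∈ carrier (L.splice i M) c
  comp_mem_right : ∀ {L M : SymList C} {c : C} (i : Fin L.len) (x : P.coll.sp L c)
    (y : P.coll.sp M (L.obj i)), y ∈ carrier M (L.obj i) →
      P.comp i x y ∈ carrier (L.splice i M) c

namespace COperad.Ideal

/-- The smallest operadic ideal that contains a given set of operations. -/
def span {k : Type u} [Field k] {C : Type u₁} [Category.{v₁} C] (P : COperad.{w} k C)
    (S : ∀ (L : SymList C) (c : C), Set (P.coll.sp L c)) : Ideal P where
  carrier L c := ⨅ (I : Ideal P) (_ : ∀ L c, S L c ⊆ I.carrier L c), I.carrier L c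
  act_mem φ f x hx := by
    simp only [Submodule.mem_iInf] at hx ⊢
    exact fun I hI => I.act_mem φ f x (hx I hI)
  comp_mem_left i x y hx := by
    simp only [Submodule.mem_iInf] at hx ⊢
    exact fun I hI => I.comp_mem_left i x y (hx I hI)
  comp_mem_right i x y hy := by
    simp only [Submodule.mem_iInf] at hy ⊢
    exact fun I hI => I.comp_mem_right i x y (hy I hI)

/-- The underlying collection of the quotient operad. -/
def quotColl {k : Type u} [Field k] {C : Type u₁} [Category.{v₁} C] {P : COperad.{w} k C}
    (I : Ideal P) : Coll.{w} k C :=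
  Coll.mk' (fun L c => P.coll.sp L c ⧸ I.carrier L c)
    (fun {L L' c c'} φ f =>
      (I.carrier L c).mapQ (I.carrier L' c') (P.coll.act φ f) (I.act_mem φ f))
    (fun L c x => by
      induction x using Submodule.Quotient.induction_on with
      | H x => exact congrArg Submodule.Quotient.mk (P.coll.act_id x))
    (fun φ f ψ g x => by
      induction x using Submodule.Quotient.induction_on with
      | H x => exact congrArg Submodule.Quotient.mk (P.coll.act_act φ f ψ g x).symm)

/-- The class of an operation in the quotient operad. -/
def cls {k : Type u} [Field k] {C : Type u₁} [Category.{v₁} C] {P : COperad.{w} k C}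
    (I : Ideal P) {L : SymList C} {c : C} (x : P.coll.sp L c) : I.quotColl.sp L c :=
  Submodule.Quotient.mk (p := I.carrier L c) x

theorem cls_surj {k : Type u} [Field k] {C : Type u₁} [Category.{v₁} C] {P : COperad.{w} k C}
    (I : Ideal P) {L : SymList C} {c : C} (x : I.quotColl.sp L c) : ∃ y, I.cls y = x :=
  Submodule.Quotient.mk_surjective (I.carrier L c) x

theorem act_cls {k : Type u} [Field k] {C : Type u₁} [Category.{v₁} C] {P : COperad.{w} k C}
    (I : Ideal P) {L L' : SymList C} {c c' : C} (φ : L' ⟶ L) (f : c ⟶ c') (x : P.coll.sp L c) :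
    I.quotColl.act φ f (I.cls x) = I.cls (P.coll.act φ f x) := rfl

/-- The compositions of the quotient operad. -/
def quotComp {k : Type u} [Field k] {C : Type u₁} [Category.{v₁} C] {P : COperad.{w} k C}
    (I : Ideal P) {L M : SymList C} {c : C} (i : Fin L.len) :
    I.quotColl.sp L c →ₗ[k] I.quotColl.sp M (L.obj i) →ₗ[k] I.quotColl.sp (L.splice i M) c :=
  quotBilin (I.carrier L c) (I.carrier M (L.obj i)) (I.carrier (L.splice i M) c) (P.comp i)
    (fun x hx y => I.comp_mem_left i x y hx) (fun x y hy => I.comp_mem_right i x y hy)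

theorem quotComp_cls {k : Type u} [Field k] {C : Type u₁} [Category.{v₁} C] {P : COperad.{w} k C}
    (I : Ideal P) {L M : SymList C} {c : C} (i : Fin L.len) (x : P.coll.sp L c)
    (y : P.coll.sp M (L.obj i)) : I.quotComp i (I.cls x) (I.cls y) = I.cls (P.comp i x y) := rfl

/-- The quotient `C`-operad `P / I`. -/
def quot {k : Type u} [Field k] {C : Type u₁} [Category.{v₁} C] {P : COperad.{w} k C}
    (I : Ideal P) : COperad.{w} k C where
  coll := I.quotColl
  comp i := I.quotComp i
  comp_map φ f ψ i x y := by
    obtain ⟨x, rfl⟩ := I.cls_surj x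
    obtain ⟨y, rfl⟩ := I.cls_surj y
    simp only [act_cls, quotComp_cls, P.comp_map]
  par_assoc j p h x y z := by
    obtain ⟨x, rfl⟩ := I.cls_surj x
    obtain ⟨y, rfl⟩ := I.cls_surj y
    obtain ⟨z, rfl⟩ := I.cls_surj z
    simp only [quotComp_cls, act_cls]
    exact congrArg I.cls (P.par_assoc j p h x y z)
  seq_assoc j q x y z := by
    obtain ⟨x, rfl⟩ := I.cls_surj x
    obtain ⟨y, rfl⟩ := I.cls_surj y
    obtain ⟨z, rfl⟩ := I.cls_surj z
    simp only [quotComp_cls, act_cls]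
    exact congrArg I.cls (P.seq_assoc j q x y z)

end COperad.Ideal

/-! ### Free operads -/

/-- A non-symmetric `C`-collection: functors `(Cᵒᵖ)ⁿ × C ⥤ Vect` for all `n`. -/
abbrev NSColl (k : Type u) [Field k] (C : Type u₁) [Category.{v₁} C] :=
  ∀ n : ℕ, (Fin n → C)ᵒᵖ × C ⥤ ModuleCat.{w} k

/-- Formal composites (trees whose vertices are decorated by elements of `X` and whose edges are
decorated by morphisms of `C`, with ordered leaves) of operations of a non-symmetric
collection `X`. -/
inductive Tree {k : Type u} [Field k] {C : Type u₁} [Category.{v₁} C] (X : NSColl.{w} k C) :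
    SymList C → C → Type (max w u₁ v₁)
  | gen {n : ℕ} {c : Fin n → C} {d : C} (x : (X n).obj (op c, d)) : Tree X ⟨n, c⟩ d
  | act {L L' : SymList C} {c c' : C} (φ : L' ⟶ L) (f : c ⟶ c') (t : Tree X L c) : Tree X L' c'
  | comp {L M : SymList C} {c : C} (i : Fin L.len) (t : Tree X L c) (s : Tree X M (L.obj i)) :
      Tree X (L.splice i M) c

namespace Tree

/-- The number of vertices. -/
def vertices {k : Type u} [Field k] {C : Type u₁} [Category.{v₁} C] {X : NSColl.{w} k C} :
    ∀ {L : SymList C} {c : C}, Tree X L c → ℕ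
  | _, _, gen _ => 1
  | _, _, act _ _ t => t.vertices
  | _, _, comp _ t s => t.vertices + s.vertices

/-- The axioms of a `C`-operad, and the naturality of the inclusion of the generators, as
identifications of formal composites. -/
inductive Rel {k : Type u} [Field k] {C : Type u₁} [Category.{v₁} C] {X : NSColl.{w} k C} :
    ∀ {L : SymList C} {c : C}, Tree X L c → Tree X L c → Prop
  | gen_nat {n : ℕ} {c c' : Fin n → C} {d d' : C} (g : c' ⟶ c) (f : d ⟶ d')
      (x : (X n).obj (op c, d)) :
      Rel (act (SymList.ofPi g) f (gen x))
        (gen (((X n).map (X := (op c, d)) (Y := (op c', d')) (Prod.mkHom g.op f)).hom x))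
  | act_id {L : SymList C} {c : C} (t : Tree X L c) : Rel (act (𝟙 L) (𝟙 c) t) t
  | act_act {L L' L'' : SymList C} {c c' c'' : C} (φ : L' ⟶ L) (f : c ⟶ c') (ψ : L'' ⟶ L')
      (g : c' ⟶ c'') (t : Tree X L c) : Rel (act ψ g (act φ f t)) (act (ψ ≫ φ) (f ≫ g) t)
  | comp_map {L L' M M' : SymList C} {c c' : C} (φ : L' ⟶ L) (f : c ⟶ c') (ψ : M' ⟶ M)
      (i : Fin L'.len) (t : Tree X L c) (s : Tree X M (L'.obj i)) :
      Rel (comp i (act φ f t) (act ψ (𝟙 _) s))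
        (act (SymList.spliceHom φ i ψ) f (comp (φ.perm i) t (act (𝟙 M) (φ.hom i) s)))
  | par_assoc {L M N : SymList C} {c : C} (j p : Fin L.len) (h : p ≠ j) (x : Tree X L c)
      (y : Tree X M (L.obj j)) (z : Tree X N (L.obj p)) :
      Rel (comp (outer M.len j p h) (comp j x y)
          (act (𝟙 N) (eqToHom (L.splice_outer j M p h).symm) z))
        (act (SymList.parHom L M N j p h) (𝟙 c)
          (comp (outer N.len p j h.symm) (comp p x z)
            (act (𝟙 M) (eqToHom (L.splice_outer p N j h.symm).symm) y)))
  | seq_assoc {L M N : SymList C} {c : C} (j : Fin L.len) (q : Fin M.len) (x : Tree X L c)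
      (y : Tree X M (L.obj j)) (z : Tree X N (M.obj q)) :
      Rel (comp (inner j q) (comp j x y)
          (act (𝟙 N) (eqToHom (L.splice_inner j M q).symm) z))
        (act (SymList.seqHom L M N j q) (𝟙 c) (comp j x (comp q y z)))

end Tree

namespace FreeOp

section
variable {k : Type u} [Field k] {C : Type u₁} [Category.{v₁} C] (X : NSColl.{w} k C)

/-- Linear combinations of formal composites. -/
abbrev Lin (L : SymList C) (c : C) : Type (max w u₁ v₁ u) := Tree X L c →₀ k

variable {X} in
/-- A formal composite as a linear combination. -/
def single {L : SymList C} {c : C} (t : Tree X L c) : Lin X L c := Finsupp.single t 1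

/-- The linear extension of the action. -/
def linAct {L L' : SymList C} {c c' : C} (φ : L' ⟶ L) (f : c ⟶ c') :
    Lin X L c →ₗ[k] Lin X L' c' :=
  Finsupp.lmapDomain k k (Tree.act φ f)

/-- The bilinear extension of the composition. -/
def linComp {L M : SymList C} {c : C} (i : Fin L.len) :
    Lin X L c →ₗ[k] Lin X M (L.obj i) →ₗ[k] Lin X (L.splice i M) c :=
  Finsupp.linearCombination k fun t : Tree X L c => Finsupp.lmapDomain k k (Tree.comp i t)

theorem linAct_single {L L' : SymList C} {c c' : C} (φ : L' ⟶ L) (f : c ⟶ c')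
    (t : Tree X L c) : linAct X φ f (single t) = single (Tree.act φ f t) := by
  simp [linAct, single]

theorem linComp_single {L M : SymList C} {c : C} (i : Fin L.len) (t : Tree X L c)
    (s : Tree X M (L.obj i)) : linComp X i (single t) (single s) = single (Tree.comp i t s) := by
  simp [linComp, single]

/-- The linear combinations of formal composites that are zero in the free operad: the smallest
family of subspaces that contains the axioms of a `C`-operad and the linearity of the inclusion
of the generators, and is closed under the operations. -/
inductive IsZero : ∀ {L : SymList C} {c : C}, Lin X L c → Prop
  | rel {L : SymList C} {c : C} {t s : Tree X L c} (h : Tree.Rel t s) :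
      IsZero (single t - single s)
  | gen_add {n : ℕ} {c : Fin n → C} {d : C} (x y : (X n).obj (op c, d)) :
      IsZero (single (Tree.gen (x + y)) - (single (Tree.gen x) + single (Tree.gen y)))
  | gen_smul {n : ℕ} {c : Fin n → C} {d : C} (a : k) (x : (X n).obj (op c, d)) :
      IsZero (single (Tree.gen (a • x)) - a • single (Tree.gen x))
  | zero {L : SymList C} {c : C} : IsZero (0 : Lin X L c)
  | add {L : SymList C} {c : C} {x y : Lin X L c} : IsZero x → IsZero y → IsZero (x + y)
  | smul {L : SymList C} {c : C} (a : k) {x : Lin X L c} : IsZero x → IsZero (a • x)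
  | act {L L' : SymList C} {c c' : C} (φ : L' ⟶ L) (f : c ⟶ c') {x : Lin X L c} :
      IsZero x → IsZero (linAct X φ f x)
  | comp_left {L M : SymList C} {c : C} (i : Fin L.len) {x : Lin X L c}
      (y : Lin X M (L.obj i)) : IsZero x → IsZero (linComp X i x y)
  | comp_right {L M : SymList C} {c : C} (i : Fin L.len) (x : Lin X L c)
      {y : Lin X M (L.obj i)} : IsZero y → IsZero (linComp X i x y)

/-- The subspaces of the linear combinations that are zero in the free operad. -/
def zeroSub (L : SymList C) (c : C) : Submodule k (Lin X L c) where
  carrier := {x | IsZero X x}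
  zero_mem' := IsZero.zero
  add_mem' hx hy := IsZero.add hx hy
  smul_mem' a _ hx := IsZero.smul a hx

variable {X} in
/-- The class of a formal composite in the free operad. -/
def cls {L : SymList C} {c : C} (t : Tree X L c) : Lin X L c ⧸ zeroSub X L c :=
  Submodule.Quotient.mk (single t)

variable {X} in
theorem cls_eq {L : SymList C} {c : C} {t s : Tree X L c} (h : Tree.Rel t s) : cls t = cls s :=
  (Submodule.Quotient.eq _).2 (IsZero.rel h)

variable {X} in
theorem induct {L : SymList C} {c : C} {p : Lin X L c ⧸ zeroSub X L c → Prop} (h0 : p 0)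
    (hadd : ∀ x y, p x → p y → p (x + y)) (hsmul : ∀ (a : k) x, p x → p (a • x))
    (ht : ∀ t, p (cls t)) (x : Lin X L c ⧸ zeroSub X L c) : p x := by
  obtain ⟨x, rfl⟩ := Submodule.Quotient.mk_surjective _ x
  induction x using Finsupp.induction_linear with
  | zero => exact h0
  | add f g hf hg => exact hadd _ _ hf hg
  | single t a =>
    have : Finsupp.single t a = a • single t := by simp [single]
    rw [this]
    exact hsmul a _ (ht t)

/-- The action on the free operad. -/
def qAct {L L' : SymList C} {c c' : C} (φ : L' ⟶ L) (f : c ⟶ c') :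
    (Lin X L c ⧸ zeroSub X L c) →ₗ[k] (Lin X L' c' ⧸ zeroSub X L' c') :=
  (zeroSub X L c).mapQ (zeroSub X L' c') (linAct X φ f) fun _ hx => IsZero.act φ f hx

/-- The composition of the free operad. -/
def qComp {L M : SymList C} {c : C} (i : Fin L.len) :
    (Lin X L c ⧸ zeroSub X L c) →ₗ[k] (Lin X M (L.obj i) ⧸ zeroSub X M (L.obj i)) →ₗ[k]
      (Lin X (L.splice i M) c ⧸ zeroSub X (L.splice i M) c) :=
  quotBilin _ _ _ (linComp X i) (fun _ hx y => IsZero.comp_left i y hx)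
    (fun x _ hy => IsZero.comp_right i x hy)

theorem qAct_cls {L L' : SymList C} {c c' : C} (φ : L' ⟶ L) (f : c ⟶ c') (t : Tree X L c) :
    qAct X φ f (cls t) = cls (Tree.act φ f t) :=
  congrArg Submodule.Quotient.mk (linAct_single X φ f t)

theorem qComp_cls {L M : SymList C} {c : C} (i : Fin L.len) (t : Tree X L c)
    (s : Tree X M (L.obj i)) : qComp X i (cls t) (cls s) = cls (Tree.comp i t s) :=
  congrArg Submodule.Quotient.mk (linComp_single X i t s)

/-- The underlying collection of the free operad. -/
def coll : Coll.{max w u₁ v₁ u} k C :=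
  Coll.mk' (fun L c => Lin X L c ⧸ zeroSub X L c) (qAct X)
    (fun L c x => by
      induction x using induct with
      | h0 => simp
      | hadd x y hx hy => simp [hx, hy]
      | hsmul a x hx => simp [hx]
      | ht t => rw [qAct_cls, cls_eq (Tree.Rel.act_id t)])
    (fun φ f ψ g x => by
      induction x using induct with
      | h0 => simp
      | hadd x y hx hy => simp [hx, hy]
      | hsmul a x hx => simp [hx]
      | ht t => rw [qAct_cls, qAct_cls, qAct_cls, cls_eq (Tree.Rel.act_act φ f ψ g t)])

theorem coll_act {L L' : SymList C} {c c' : C} (φ : L' ⟶ L) (f : c ⟶ c') :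
    (coll X).act φ f = qAct X φ f := rfl

theorem qComp_map {L L' M M' : SymList C} {c c' : C} (φ : L' ⟶ L) (f : c ⟶ c') (ψ : M' ⟶ M)
    (i : Fin L'.len) (x : Lin X L c ⧸ zeroSub X L c)
    (y : Lin X M (L'.obj i) ⧸ zeroSub X M (L'.obj i)) :
    qComp X i (qAct X φ f x) (qAct X ψ (𝟙 _) y) =
      qAct X (SymList.spliceHom φ i ψ) f (qComp X (φ.perm i) x (qAct X (𝟙 M) (φ.hom i) y)) := by
  induction x using induct with
  | h0 => simp
  | hadd x y hx hy => simp [hx, hy]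
  | hsmul a x hx => simp [hx]
  | ht t =>
    induction y using induct with
    | h0 => simp
    | hadd x y hx hy => simp [hx, hy]
    | hsmul a x hx => simp [hx]
    | ht s =>
      simp only [qAct_cls, qComp_cls]
      exact cls_eq (Tree.Rel.comp_map φ f ψ i t s)

theorem qComp_par {L M N : SymList C} {c : C} (j p : Fin L.len) (h : p ≠ j)
    (x : Lin X L c ⧸ zeroSub X L c) (y : Lin X M (L.obj j) ⧸ zeroSub X M (L.obj j))
    (z : Lin X N (L.obj p) ⧸ zeroSub X N (L.obj p)) :
    qComp X (L := L.splice j M) (outer M.len j p h) (qComp X j x y)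
        (qAct X (𝟙 N) (eqToHom (L.splice_outer j M p h).symm) z) =
      qAct X (SymList.parHom L M N j p h) (𝟙 c)
        (qComp X (L := L.splice p N) (outer N.len p j h.symm) (qComp X p x z)
          (qAct X (𝟙 M) (eqToHom (L.splice_outer p N j h.symm).symm) y)) := by
  induction x using induct with
  | h0 => simp
  | hadd x y hx hy => simp [hx, hy]
  | hsmul a x hx => simp [hx]
  | ht x =>
    induction y using induct with
    | h0 => simp
    | hadd x y hx hy => simp [hx, hy]
    | hsmul a x hx => simp [hx]
    | ht y =>
      induction z using induct with
      | h0 => simp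
      | hadd x y hx hy => simp [hx, hy]
      | hsmul a x hx => simp [hx]
      | ht z =>
        simp only [qAct_cls, qComp_cls]
        erw [qComp_cls, qComp_cls, qAct_cls]
        exact cls_eq (Tree.Rel.par_assoc j p h x y z)

theorem qComp_seq {L M N : SymList C} {c : C} (j : Fin L.len) (q : Fin M.len)
    (x : Lin X L c ⧸ zeroSub X L c) (y : Lin X M (L.obj j) ⧸ zeroSub X M (L.obj j))
    (z : Lin X N (M.obj q) ⧸ zeroSub X N (M.obj q)) :
    qComp X (L := L.splice j M) (inner j q) (qComp X j x y)
        (qAct X (𝟙 N) (eqToHom (L.splice_inner j M q).symm) z) =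
      qAct X (SymList.seqHom L M N j q) (𝟙 c) (qComp X j x (qComp X q y z)) := by
  induction x using induct with
  | h0 => simp
  | hadd x y hx hy => simp [hx, hy]
  | hsmul a x hx => simp [hx]
  | ht x =>
    induction y using induct with
    | h0 => simp
    | hadd x y hx hy => simp [hx, hy]
    | hsmul a x hx => simp [hx]
    | ht y =>
      induction z using induct with
      | h0 => simp
      | hadd x y hx hy => simp [hx, hy]
      | hsmul a x hx => simp [hx]
      | ht z =>
        simp only [qAct_cls, qComp_cls]
        erw [qComp_cls]
        exact cls_eq (Tree.Rel.seq_assoc j q x y z)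

end
end FreeOp

/-- The free (non-unital, symmetric) `C`-operad on a non-symmetric `C`-collection. -/
def freeOperad {k : Type u} [Field k] {C : Type u₁} [Category.{v₁} C] (X : NSColl.{w} k C) :
    COperad.{max w u₁ v₁ u} k C where
  coll := FreeOp.coll X
  comp i := FreeOp.qComp X i
  comp_map φ f ψ i x y := by
    simp only [FreeOp.coll_act]
    exact FreeOp.qComp_map X φ f ψ i x y
  par_assoc j p h x y z := by
    simp only [FreeOp.coll_act]
    exact FreeOp.qComp_par X j p h x y z
  seq_assoc j q x y z := by
    simp only [FreeOp.coll_act]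
    exact FreeOp.qComp_seq X j q x y z

/-- The inclusion of the generators into the free operad. -/
def freeGen {k : Type u} [Field k] {C : Type u₁} [Category.{v₁} C] (X : NSColl.{w} k C)
    {n : ℕ} {c : Fin n → C} {d : C} (x : (X n).obj (op c, d)) :
    (freeOperad X).coll.sp ⟨n, c⟩ d :=
  FreeOp.cls (Tree.gen x)

/-- The operations of weight `a`: linear combinations of trees with `a` vertices. -/
def weightPart {k : Type u} [Field k] {C : Type u₁} [Category.{v₁} C] (X : NSColl.{w} k C)
    (a : ℕ) (L : SymList C) (c : C) : Submodule k ((freeOperad X).coll.sp L c) :=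
  Submodule.span k {y | ∃ t : Tree X L c, t.vertices = a ∧ FreeOp.cls t = y}

/-- A `C`-operad is binary quadratic if it is (isomorphic to) the quotient of a free operad
`F(X)`, where `X` is concentrated in arity two, by the ideal generated by a set of operations of
weight two. -/
def IsBinaryQuadratic {k : Type u} [Field k] {C : Type u₁} [Category.{v₁} C]
    (P : COperad.{w₁} k C) : Prop :=
  ∃ (X : NSColl.{w} k C) (S : ∀ (L : SymList C) (c : C), Set ((freeOperad X).coll.sp L c)),
    (∀ n, n ≠ 2 → ∀ c d, Subsingleton ((X n).obj (op c, d))) ∧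
    (∀ L c, S L c ⊆ weightPart X 2 L c) ∧
    ∃ f : COperad.Hom P (COperad.Ideal.span (freeOperad X) S).quot,
      ∀ L c, Function.Bijective (f.app L c)

/-! ### The groupoid of colors and classical Markl operads -/

/-- Objects of the groupoid `Σ`: natural numbers. -/
structure Sig where
  /-- the natural number -/
  arity : ℕ

namespace Sig

/-- Morphisms of `Σ` are permutations. (A bijection `Fin m ≃ Fin n` exists only for `n = m`.)
The composition of `Σ` is such that `σ ≫ τ` is the product `σ τ` of permutations, so that a functor
from `Σ` is a sequence of right modules over the symmetric groups. -/
instance : Category Sig where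
  Hom a b := Fin b.arity ≃ Fin a.arity
  id a := Equiv.refl (Fin a.arity)
  comp f g := Equiv.trans g f

/-- A permutation as a morphism of `Σ`. -/
def ofPerm {n m : ℕ} (σ : Fin m ≃ Fin n) : Sig.mk n ⟶ Sig.mk m := σ

/-- The identification of two equal objects. -/
def castHom {n m : ℕ} (h : n = m) : Sig.mk n ⟶ Sig.mk m := ofPerm (finCongr h.symm)

/-- The (right) action of a permutation on the values of a functor on `Σ`. -/
def perm {k : Type u} [Field k] (M : Sig ⥤ ModuleCat.{v} k) {n m : ℕ} (σ : Fin m ≃ Fin n) :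
    M.obj ⟨n⟩ →ₗ[k] M.obj ⟨m⟩ := (M.map (ofPerm σ)).hom

/-- The identification of the values of a functor at two equal natural numbers. -/
def cast {k : Type u} [Field k] (M : Sig ⥤ ModuleCat.{v} k) {n m : ℕ} (h : n = m) :
    M.obj ⟨n⟩ →ₗ[k] M.obj ⟨m⟩ := (M.map (castHom h)).hom

end Sig

/-- The structure of a classical symmetric non-unital Markl operad on a sequence of right modules
over the symmetric groups. -/
@[ext]
structure MarklStr {k : Type u} [Field k] (M : Sig ⥤ ModuleCat.{v} k) where
  /-- the partial compositions `∘ᵢ : M(n) ⊗ M(m) → M(n + m - 1)` -/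
  comp : ∀ {n m : ℕ} (_ : Fin n), M.obj ⟨n⟩ →ₗ[k] M.obj ⟨m⟩ →ₗ[k] M.obj ⟨n + m - 1⟩
  /-- `(x σ) ∘ᵢ (y τ) = (x ∘_{σ(i)} y) (σ ∘ᵢ τ)` -/
  equivariance : ∀ {n m : ℕ} (σ : Equiv.Perm (Fin n)) (τ : Equiv.Perm (Fin m)) (i : Fin n)
    (x : M.obj ⟨n⟩) (y : M.obj ⟨m⟩),
    comp i (Sig.perm M σ x) (Sig.perm M τ y) =
      Sig.perm M (insertPerm σ i τ) (comp (σ i) x y)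
  /-- parallel associativity: plugging `y` and `z` into different inputs `j` and `p` of `x` -/
  par_assoc : ∀ {n m l : ℕ} (j p : Fin n) (h : p ≠ j) (x : M.obj ⟨n⟩) (y : M.obj ⟨m⟩)
    (z : M.obj ⟨l⟩),
    Sig.cast M (par_len m l j p h) (comp (outer m j p h) (comp j x y) z) =
      comp (outer l p j h.symm) (comp p x z) y
  /-- sequential associativity: plugging `z` into the input `q` of `y`, which is plugged into the
  input `j` of `x` -/
  seq_assoc : ∀ {n m l : ℕ} (j : Fin n) (q : Fin m) (x : M.obj ⟨n⟩) (y : M.obj ⟨m⟩)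
    (z : M.obj ⟨l⟩),
    Sig.cast M (seq_len l j q) (comp (inner j q) (comp j x y) z) = comp j x (comp q y z)

/-- A classical symmetric non-unital Markl operad in `k`-vector spaces. -/
structure MarklOperad (k : Type u) [Field k] where
  /-- the underlying sequence of right modules over the symmetric groups -/
  coll : Sig ⥤ ModuleCat.{v} k
  /-- the operad structure -/
  str : MarklStr coll

namespace MarklOperad

/-- A morphism of Markl operads: equivariant linear maps that preserve the compositions. -/
@[ext]
structure Hom {k : Type u} [Field k] (A B : MarklOperad.{v} k) where
  /-- the underlying equivariant maps -/
  nat : A.coll ⟶ B.coll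
  nat_comp : ∀ {n m : ℕ} (i : Fin n) (x : A.coll.obj ⟨n⟩) (y : A.coll.obj ⟨m⟩),
    (nat.app ⟨n + m - 1⟩).hom (A.str.comp i x y) =
      B.str.comp i ((nat.app ⟨n⟩).hom x) ((nat.app ⟨m⟩).hom y)

instance {k : Type u} [Field k] : Category (MarklOperad.{v} k) where
  Hom A B := Hom A B
  id A := ⟨𝟙 A.coll, fun i x y => by simp⟩
  comp f g := ⟨f.nat ≫ g.nat, fun i x y => by simp [f.nat_comp, g.nat_comp]⟩

/-- The functor from Markl operads to sequences of right modules. -/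
def forget (k : Type u) [Field k] : MarklOperad.{v} k ⥤ (Sig ⥤ ModuleCat.{v} k) where
  obj A := A.coll
  map f := f.nat

end MarklOperad

/-! ### The hyperoperad -/

/-- The subspaces generated by the differences `a - b` of related elements `a ~ b`; these are the
differences of the pairs in the equivalence relation generated by `a ~ b`. -/
def relSub {k : Type u} [Field k] {D : Type u₁} [Category.{v₁} D] (F : D ⥤ ModuleCat.{w} k)
    (R : ∀ d, F.obj d → F.obj d → Prop) (d : D) : Submodule k (F.obj d) :=
  Submodule.span k {y | ∃ (d' : D) (f : d' ⟶ d) (a b : F.obj d'), R d' a b ∧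
    (F.map f).hom (a - b) = y}

theorem relSub_map {k : Type u} [Field k] {D : Type u₁} [Category.{v₁} D]
    (F : D ⥤ ModuleCat.{w} k) (R : ∀ d, F.obj d → F.obj d → Prop) {d e : D} (g : d ⟶ e) :
    relSub F R d ≤ (relSub F R e).comap (F.map g).hom := by
  refine Submodule.span_le.2 ?_
  rintro _ ⟨d', f, a, b, h, rfl⟩
  refine Submodule.subset_span ⟨d', f ≫ g, a, b, h, ?_⟩
  simp

/-- The quotient of a functor by the equivalence relation generated by `R`. -/
def quotFunctor {k : Type u} [Field k] {D : Type u₁} [Category.{v₁} D] (F : D ⥤ ModuleCat.{w} k)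
    (R : ∀ d, F.obj d → F.obj d → Prop) : D ⥤ ModuleCat.{w} k where
  obj d := ModuleCat.of k (F.obj d ⧸ relSub F R d)
  map {d e} g := ModuleCat.ofHom
    ((relSub F R d).mapQ (relSub F R e) (F.map g).hom (relSub_map F R g))
  map_id d := by
    ext x
    exact congrArg Submodule.Quotient.mk (congrArg (fun g => g.hom x) (F.map_id d))
  map_comp f g := by
    ext x
    exact congrArg Submodule.Quotient.mk (congrArg (fun g => g.hom x) (F.map_comp f g))

/-- The scheme `(*ᵢ, σ τ; π)`, standing for the composite of `(-)σ ⊗ (-)τ`,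
`∘ᵢ : M(n) ⊗ M(m) → M(n + m - 1)`, and `(-)π`. (As `σ`, `τ` and `π` are permutations, the inputs
are of colors `n` and `m` and the output is of color `n + m - 1`.) -/
structure Scheme (a b c : Sig) where
  /-- the arity of the first operation -/
  n : ℕ
  /-- the arity of the second operation -/
  m : ℕ
  /-- the index of `*ᵢ` -/
  i : Fin n
  /-- the permutation acting on the first input -/
  σ : a ⟶ ⟨n⟩
  /-- the permutation acting on the second input -/
  τ : b ⟶ ⟨m⟩
  /-- the permutation acting on the output -/
  π : ⟨n + m - 1⟩ ⟶ c

/-- The action of permutations on schemes. -/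
def Scheme.act {a b c a' b' c' : Sig} (f : a' ⟶ a) (g : b' ⟶ b) (h : c ⟶ c')
    (s : Scheme a b c) : Scheme a' b' c' :=
  ⟨s.n, s.m, s.i, f ≫ s.σ, g ≫ s.τ, s.π ≫ h⟩

/-- The binary part of the generating collection `X`, freely spanned by schemes. -/
def genX (k : Type u) [Field k] : (Fin 2 → Sig)ᵒᵖ × Sig ⥤ ModuleCat.{u} k where
  obj Z := ModuleCat.of k (Scheme (Z.1.unop 0) (Z.1.unop 1) Z.2 →₀ k)
  map f := ModuleCat.ofHom
    (Finsupp.lmapDomain k k (Scheme.act (f.1.unop 0) (f.1.unop 1) f.2))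
  map_id Z := by
    ext s
    simp [Scheme.act]
  map_comp f g := by
    ext s
    simp [Scheme.act]

/-- The scheme `(*ᵢ, σ τ; π)` as a generator. -/
def genScheme (k : Type u) [Field k] {n m : ℕ} (i : Fin n) (σ : Equiv.Perm (Fin n))
    (τ : Equiv.Perm (Fin m)) (π : Equiv.Perm (Fin (n + m - 1))) :
    (genX k).obj (op ![Sig.mk n, Sig.mk m], Sig.mk (n + m - 1)) :=
  Finsupp.single (⟨n, m, i, Sig.ofPerm σ, Sig.ofPerm τ, Sig.ofPerm π⟩ :
    Scheme (Sig.mk n) (Sig.mk m) (Sig.mk (n + m - 1))) (1 : k)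

/-- The pairs `(*ᵢ, σ τ; 1) ~ (*_{σ(i)}, 1 1; σ ∘ᵢ τ)`. -/
inductive EqPair (k : Type u) [Field k] :
    ∀ Z : (Fin 2 → Sig)ᵒᵖ × Sig, (genX k).obj Z → (genX k).obj Z → Prop
  | mk {n m : ℕ} (i : Fin n) (σ : Equiv.Perm (Fin n)) (τ : Equiv.Perm (Fin m)) :
      EqPair k (op ![Sig.mk n, Sig.mk m], Sig.mk (n + m - 1))
        (genScheme k i σ τ 1) (genScheme k (σ i) 1 1 (insertPerm σ i τ))

/-- The generating collection `Q = X / Eq`, concentrated in arity two. -/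
def collQ (k : Type u) [Field k] : NSColl.{u} k Sig
  | 2 => quotFunctor (genX k) (EqPair k)
  | _ => (Functor.const _).obj (ModuleCat.of k PUnit)

/-- The class `[*ᵢ]` in `Q`. -/
def starQ (k : Type u) [Field k] {n m : ℕ} (i : Fin n) :
    (collQ k 2).obj (op ![Sig.mk n, Sig.mk m], Sig.mk (n + m - 1)) :=
  Submodule.Quotient.mk (p := relSub (genX k) (EqPair k) _) (genScheme k i 1 1 1)

/-- The list `(n m)` of colors. -/
abbrev colors (n m : ℕ) : SymList Sig := ⟨2, ![Sig.mk n, Sig.mk m]⟩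

/-- The class `[*ᵢ]` in the free operad `F(Q)`. -/
def star (k : Type u) [Field k] {n m : ℕ} (i : Fin n) :
    (freeOperad (collQ k)).coll.sp (colors n m) (Sig.mk (n + m - 1)) :=
  freeGen (collQ k) (starQ k i)

/-- The inputs of `[*] ∘₁ [*]` are of colors `n`, `m` and `l`. -/
theorem colors_left (n m l : ℕ) : ((colors (n + m - 1) l).splice 0 (colors n m)).obj =
    ![Sig.mk n, Sig.mk m, Sig.mk l] := by
  funext r
  fin_cases r <;> rfl

/-- The inputs of `[*] ∘₂ [*]` are of colors `n`, `m` and `l`. -/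
theorem colors_right (n m l : ℕ) : ((colors n (m + l - 1)).splice 1 (colors m l)).obj =
    ![Sig.mk n, Sig.mk m, Sig.mk l] := by
  funext r
  fin_cases r <;> rfl

/-- The transposition of the second and the third input. -/
def tauHom (n m l : ℕ) : (colors (n + m - 1) l).splice 0 (colors n m) ⟶
    (colors (n + l - 1) m).splice 0 (colors n l) where
  perm := Equiv.swap (1 : Fin 3) (2 : Fin 3)
  hom r := eqToHom (by
    rw [colors_left, colors_left]
    fin_cases r <;> rfl)

/-- The identification of the lists of inputs of `[*] ∘₁ [*]` and `[*] ∘₂ [*]`. -/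
def assocHom (n m l : ℕ) : (colors (n + m - 1) l).splice 0 (colors n m) ⟶
    (colors n (m + l - 1)).splice 1 (colors m l) :=
  SymList.castHom rfl fun r => by
    rw [colors_left, colors_right]
    rfl

/-- The associators. In `par`, two operations are plugged into different inputs `j` and `p` of an
operation of arity `n`; in `seq`, an operation is plugged into the input `q` of an operation of
arity `m`, which is plugged into the input `j` of an operation of arity `n`. -/
inductive Associator (k : Type u) [Field k] :
    ∀ (L : SymList Sig) (c : Sig), (freeOperad (collQ k)).coll.sp L c → Prop
  | par {n m l : ℕ} (j p : Fin n) (h : p ≠ j) :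
      Associator k _ _
        ((freeOperad (collQ k)).comp (L := colors (n + m - 1) l) (M := colors n m) 0
            (star k (outer m j p h)) (star k j) -
          (freeOperad (collQ k)).coll.act (tauHom n m l) (Sig.castHom (par_len m l j p h).symm)
            ((freeOperad (collQ k)).comp (L := colors (n + l - 1) m) (M := colors n l) 0
              (star k (outer l p j h.symm)) (star k p)))
  | seq {n m l : ℕ} (j : Fin n) (q : Fin m) :
      Associator k _ _
        ((freeOperad (collQ k)).comp (L := colors (n + m - 1) l) (M := colors n m) 0
            (star k (inner j q)) (star k j) -
          (freeOperad (collQ k)).coll.act (assocHom n m l) (Sig.castHom (seq_len l j q).symm)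
            ((freeOperad (collQ k)).comp (L := colors n (m + l - 1)) (M := colors m l) 1
              (star k j) (star k q)))

/-- The operadic ideal `As` generated by the associators. -/
def idealAs (k : Type u) [Field k] : COperad.Ideal (freeOperad (collQ k)) :=
  COperad.Ideal.span (freeOperad (collQ k)) fun L c => {x | Associator k L c x}

/-- The `Σ`-operad `ℍ = F(Q) / As`. -/
def hyperoperad (k : Type u) [Field k] : COperad.{u} k Sig := (idealAs k).quot

/-- The class of `*ᵢ` in `ℍ`. -/
def starH (k : Type u) [Field k] {n m : ℕ} (i : Fin n) :
    (hyperoperad k).coll.sp (colors n m) (Sig.mk (n + m - 1)) :=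
  (idealAs k).cls (star k i)

/-- The pair `(x, y)` as a family indexed by the list `(n m)`. -/
def pairArg {k : Type u} [Field k] (M : Sig ⥤ ModuleCat.{v} k) {n m : ℕ} (x : M.obj ⟨n⟩)
    (y : M.obj ⟨m⟩) : ∀ r : Fin (colors n m).len, M.obj ((colors n m).obj r)
  | ⟨0, _⟩ => x
  | ⟨1, _⟩ => y

end

end CatOperad

open CategoryTheory CatOperad

/-! A morphism of operads out of `F(Q)/As` is determined by the images of the classes `[*ᵢ]`, and
every choice of images that respects the imposed relations extends to one. With target the
endomorphism operad of `M`, such a choice is a bilinear map `M(n) ⊗ M(m) → M(n + m - 1)` for each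
`i`, and the relations become the axioms of a Markl operad. The relation that divides `X` into `Q`
is equivariance, the associators `par` are parallel associativity (this one family covers both outer
ranges of the indices), and the associators `seq` are sequential associativity. So for fixed `M` the
algebra structures and the Markl structures are the same data.

From algebras to Markl operads, the relations `starH_act`, `starH_par` and `starH_seq` are evaluated
on pairs and triples of elements, which yields `marklStr`. In the other direction, equivariance lets
the action of schemes descend to `Q` (`relSub_le_ker`), the universal property of the free operad
extends it to `F(Q)` (`FreeOp.lift`), and the two associativities make it vanish on `As`
(`freeHom_associator`); the result is `hyperHom`.

One round trip is the computation `starOp_apply`. The other one, and the statement on morphisms,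
rest on generation: everything in `ℍ` arises from the `[*ᵢ]` by linear combinations, actions and
compositions (`hyperoperad_generated`). Hence a natural transformation compatible with the `[*ᵢ]` is
compatible with all operations (`nat_eval_of_starH`), and the identity transformation gives
uniqueness of the structure morphism (`ext_marklStr`).

Binary quadraticity is visible from the presentation: `Q` lives in arity two, and an associator is a
difference of two trees with two vertices each. -/

namespace CatOperad

noncomputable section

/-! ### The universal property of free operads -/

namespace FreeOp

section
variable {k : Type u} [Field k] {C : Type u₁} [Category.{v₁} C] {X : NSColl.{w} k C}
  {P : COperad.{w₂} k C}
  (g : ∀ (n : ℕ) (c : Fin n → C) (d : C), (X n).obj (op c, d) →ₗ[k] P.coll.sp ⟨n, c⟩ d)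

/-- The value of a formal composite in an operad, given the values of the generators. -/
def evalTree : ∀ {L : SymList C} {c : C}, Tree X L c → P.coll.sp L c
  | _, _, .gen x => g _ _ _ x
  | _, _, .act φ f t => P.coll.act φ f (evalTree t)
  | _, _, .comp i t s => P.comp i (evalTree t) (evalTree s)

/-- The linear extension of `evalTree`. -/
def evalLin (L : SymList C) (c : C) : Lin X L c →ₗ[k] P.coll.sp L c :=
  Finsupp.linearCombination k (evalTree g)

theorem evalLin_single {L : SymList C} {c : C} (t : Tree X L c) :
    evalLin g L c (single t) = evalTree g t := by
  simp [evalLin, single]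

theorem evalLin_act {L L' : SymList C} {c c' : C} (φ : L' ⟶ L) (f : c ⟶ c') (x : Lin X L c) :
    evalLin g L' c' (linAct X φ f x) = P.coll.act φ f (evalLin g L c x) := by
  induction x using Finsupp.induction_linear with
  | zero => simp
  | add x y hx hy => simp only [map_add, hx, hy]
  | single t a => simp [linAct, evalLin, evalTree]

theorem evalLin_comp {L M : SymList C} {c : C} (i : Fin L.len) (x : Lin X L c)
    (y : Lin X M (L.obj i)) :
    evalLin g (L.splice i M) c (linComp X i x y) =
      P.comp i (evalLin g L c x) (evalLin g M (L.obj i) y) := by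
  induction x using Finsupp.induction_linear with
  | zero => simp
  | add x x' hx hy => simp only [map_add, LinearMap.add_apply, hx, hy]
  | single t a =>
    induction y using Finsupp.induction_linear with
    | zero => simp
    | add y y' hx hy => simp only [map_add, hx, hy]
    | single s b =>
      have ht : Finsupp.single t a = a • single t := by simp [single]
      have hs : Finsupp.single s b = b • single s := by simp [single]
      rw [ht, hs]
      simp only [map_smul, LinearMap.smul_apply, linComp_single, evalLin_single, evalTree]

/-- Apart from `gen_nat`, each constructor of `Tree.Rel` is an axiom of the operad `P` read on
evaluated trees; `gen_nat` is the hypothesis `hg`. No congruence rules occur, because closure under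
actions and compositions is part of `IsZero`. -/
theorem evalTree_rel
    (hg : ∀ {n : ℕ} {c c' : Fin n → C} {d d' : C} (φ : c' ⟶ c) (f : d ⟶ d')
      (x : (X n).obj (op c, d)),
      P.coll.act (SymList.ofPi φ) f (g n c d x) =
        g n c' d' (((X n).map (X := (op c, d)) (Y := (op c', d')) (Prod.mkHom φ.op f)).hom x))
    {L : SymList C} {c : C} {t s : Tree X L c} (h : Tree.Rel t s) :
    evalTree g t = evalTree g s := by
  cases h with
  | gen_nat φ f x => exact hg φ f x
  | act_id t => exact P.coll.act_id _
  | act_act φ f ψ g t => exact P.coll.act_act _ _ _ _ _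
  | comp_map φ f ψ i t s => exact P.comp_map _ _ _ _ _ _
  | par_assoc j p h x y z => exact P.par_assoc _ _ _ _ _ _
  | seq_assoc j q x y z => exact P.seq_assoc _ _ _ _ _

/-- This is the well-definedness of `lift`. The operadic relations vanish by `evalTree_rel`, the
linearity relations on generators because `g` is linear, and the closure clauses because evaluation
commutes with actions and compositions. -/
theorem evalLin_isZero
    (hg : ∀ {n : ℕ} {c c' : Fin n → C} {d d' : C} (φ : c' ⟶ c) (f : d ⟶ d')
      (x : (X n).obj (op c, d)),
      P.coll.act (SymList.ofPi φ) f (g n c d x) =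
        g n c' d' (((X n).map (X := (op c, d)) (Y := (op c', d')) (Prod.mkHom φ.op f)).hom x))
    {L : SymList C} {c : C} {x : Lin X L c} (h : IsZero X x) : evalLin g L c x = 0 := by
  induction h with
  | rel h => rw [map_sub, evalLin_single, evalLin_single, evalTree_rel g hg h, sub_self]
  | gen_add x y => simp [evalLin_single, evalTree]
  | gen_smul a x => simp [evalLin_single, evalTree]
  | zero => exact map_zero _
  | add _ _ hx hy => rw [map_add, hx, hy, add_zero]
  | smul a _ hx => rw [map_smul, hx, smul_zero]
  | act φ f _ hx => rw [evalLin_act, hx, map_zero]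
  | comp_left i y _ hx => rw [evalLin_comp, hx, map_zero, LinearMap.zero_apply]
  | comp_right i x _ hy => rw [evalLin_comp, hy, map_zero]

/-- The morphism from a free operad given by its values on generators. -/
def lift
    (hg : ∀ {n : ℕ} {c c' : Fin n → C} {d d' : C} (φ : c' ⟶ c) (f : d ⟶ d')
      (x : (X n).obj (op c, d)),
      P.coll.act (SymList.ofPi φ) f (g n c d x) =
        g n c' d' (((X n).map (X := (op c, d)) (Y := (op c', d')) (Prod.mkHom φ.op f)).hom x)) :
    COperad.Hom (freeOperad X) P where
  app L c := (zeroSub X L c).liftQ (evalLin g L c) fun _ hx => evalLin_isZero g hg hx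
  app_act φ f x := by
    obtain ⟨x, rfl⟩ := Submodule.Quotient.mk_surjective _ x
    exact evalLin_act g φ f x
  app_comp i x y := by
    obtain ⟨x, rfl⟩ := Submodule.Quotient.mk_surjective _ x
    obtain ⟨y, rfl⟩ := Submodule.Quotient.mk_surjective _ y
    exact evalLin_comp g i x y

theorem lift_freeGen
    (hg : ∀ {n : ℕ} {c c' : Fin n → C} {d d' : C} (φ : c' ⟶ c) (f : d ⟶ d')
      (x : (X n).obj (op c, d)),
      P.coll.act (SymList.ofPi φ) f (g n c d x) =
        g n c' d' (((X n).map (X := (op c, d)) (Y := (op c', d')) (Prod.mkHom φ.op f)).hom x))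
    {n : ℕ} {c : Fin n → C} {d : C} (x : (X n).obj (op c, d)) :
    (lift g hg).app ⟨n, c⟩ d (freeGen X x) = g n c d x :=
  evalLin_single g (Tree.gen x)

/-- A family of subspaces of a free operad that contains the generators and is closed under the
operations contains everything. -/
theorem generated {p : ∀ (L : SymList C) (c : C), (freeOperad X).coll.sp L c → Prop}
    (h0 : ∀ L c, p L c 0) (hadd : ∀ L c x y, p L c x → p L c y → p L c (x + y))
    (hsmul : ∀ L c (a : k) x, p L c x → p L c (a • x))
    (hgen : ∀ (n : ℕ) (c : Fin n → C) (d : C) (x : (X n).obj (op c, d)), p _ _ (freeGen X x))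
    (hact : ∀ {L L' : SymList C} {c c' : C} (φ : L' ⟶ L) (f : c ⟶ c') (x),
      p L c x → p L' c' ((freeOperad X).coll.act φ f x))
    (hcomp : ∀ {L M : SymList C} {c : C} (i : Fin L.len) (x y), p L c x → p M (L.obj i) y →
      p (L.splice i M) c ((freeOperad X).comp i x y))
    {L : SymList C} {c : C} (x : (freeOperad X).coll.sp L c) : p L c x := by
  -- Classes of single trees suffice: the free operad is a quotient of their linear span, and `p` is
  -- stable under linear combinations.
  have key : ∀ {L : SymList C} {c : C} (t : Tree X L c), p L c (cls t) := by
    intro L c t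
    induction t with
    | gen x => exact hgen _ _ _ x
    | act φ f t ht =>
      have := hact φ f _ ht
      rwa [show (freeOperad X).coll.act φ f (cls t) = cls (Tree.act φ f t) from
        qAct_cls X φ f t] at this
    | comp i t s ht hs =>
      have := hcomp i _ _ ht hs
      rwa [show (freeOperad X).comp i (cls t) (cls s) = cls (Tree.comp i t s) from
        qComp_cls X i t s] at this
  exact induct (p := p L c) (h0 L c) (hadd L c) (hsmul L c) key x

/-- Imposed by the relation `gen_nat`. It lets morphisms of colors that act on a generator be pulled
out as an action in the operad. -/
theorem act_freeGen {n : ℕ} {c c' : Fin n → C} {d d' : C} (φ : c' ⟶ c) (f : d ⟶ d')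
    (x : (X n).obj (op c, d)) :
    (freeOperad X).coll.act (SymList.ofPi φ) f (freeGen X x) =
      freeGen X (((X n).map (X := (op c, d)) (Y := (op c', d')) (Prod.mkHom φ.op f)).hom x) :=
  (qAct_cls X _ _ _).trans (cls_eq (Tree.Rel.gen_nat φ f x))

variable (X) in
/-- The inclusion of the generators as a linear map. -/
def genLin {n : ℕ} (c : Fin n → C) (d : C) :
    (X n).obj (op c, d) →ₗ[k] (freeOperad X).coll.sp ⟨n, c⟩ d where
  toFun x := freeGen X x
  map_add' x y := (Submodule.Quotient.eq _).2 (IsZero.gen_add x y)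
  map_smul' a x := (Submodule.Quotient.eq _).2 (IsZero.gen_smul a x)

end
end FreeOp

/-! ### The universal property of quotient operads -/

namespace COperad

section
variable {k : Type u} [Field k] {C : Type u₁} [Category.{v₁} C]

/-- The kernel of a morphism of operads. -/
def Hom.ker {P : COperad.{w₁} k C} {R : COperad.{w₂} k C} (F : Hom P R) : Ideal P where
  carrier L c := LinearMap.ker (F.app L c)
  act_mem φ f x hx := by
    rw [LinearMap.mem_ker] at hx ⊢
    rw [F.app_act, hx, map_zero]
  comp_mem_left i x y hx := by
    rw [LinearMap.mem_ker] at hx ⊢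
    rw [F.app_comp, hx, map_zero, LinearMap.zero_apply]
  comp_mem_right i x y hy := by
    rw [LinearMap.mem_ker] at hy ⊢
    rw [F.app_comp, hy, map_zero]

/-- The span is an infimum over the ideals that contain `S`, and `I` is one of them. Applied to a
kernel, this reduces vanishing on the span to vanishing on `S`. -/
theorem Ideal.span_le {P : COperad.{w} k C} {S : ∀ (L : SymList C) (c : C), Set (P.coll.sp L c)}
    {I : Ideal P} (h : ∀ L c, S L c ⊆ I.carrier L c) (L : SymList C) (c : C) :
    (span P S).carrier L c ≤ I.carrier L c :=
  iInf₂_le I h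

theorem Ideal.subset_span {P : COperad.{w} k C}
    {S : ∀ (L : SymList C) (c : C), Set (P.coll.sp L c)} {L : SymList C} {c : C}
    {x : P.coll.sp L c} (hx : x ∈ S L c) : x ∈ (span P S).carrier L c := by
  simp only [span, Submodule.mem_iInf]
  exact fun I hI => hI L c hx

/-- The morphism from a quotient operad induced by a morphism that vanishes on the ideal. -/
def Ideal.liftQuot {P : COperad.{w₁} k C} {R : COperad.{w₂} k C} (I : Ideal P) (F : Hom P R)
    (h : ∀ L c, I.carrier L c ≤ LinearMap.ker (F.app L c)) : Hom I.quot R where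
  app L c := (I.carrier L c).liftQ (F.app L c) (h L c)
  app_act φ f x := by
    obtain ⟨x, rfl⟩ := I.cls_surj x
    exact F.app_act φ f x
  app_comp i x y := by
    obtain ⟨x, rfl⟩ := I.cls_surj x
    obtain ⟨y, rfl⟩ := I.cls_surj y
    exact F.app_comp i x y

/-- The identity morphism. -/
def Hom.refl (P : COperad.{w} k C) : Hom P P where
  app _ _ := LinearMap.id
  app_act _ _ _ := rfl
  app_comp _ _ _ := rfl

end
end COperad

/-! ### Binary quadraticity -/

/-- Both terms are classes of single trees built from two generators. The reindexing of the second
term is an `act` node, which contributes no vertex, so its weight is still two. -/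
theorem Associator.mem_weightPart {k : Type u} [Field k] {L : SymList Sig} {c : Sig}
    {x : (freeOperad (collQ k)).coll.sp L c} (h : Associator k L c x) :
    x ∈ weightPart (collQ k) 2 L c := by
  cases h with
  | par j p h =>
    refine Submodule.sub_mem _ (Submodule.subset_span ⟨Tree.comp _ (Tree.gen _) (Tree.gen _), rfl,
        (FreeOp.qComp_cls _ _ _ _).symm⟩)
      -- The witness is left to unification: `qComp_cls` followed by `qAct_cls` exhibits the
      -- reindexed composite as the class of one tree.
      (Submodule.subset_span ⟨_, ?_, ((congrArg _ (FreeOp.qComp_cls _ _ _ _)).trans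
        (FreeOp.qAct_cls _ _ _ _)).symm⟩)
    rfl
  | seq j q =>
    refine Submodule.sub_mem _ (Submodule.subset_span ⟨Tree.comp _ (Tree.gen _) (Tree.gen _), rfl,
        (FreeOp.qComp_cls _ _ _ _).symm⟩)
      (Submodule.subset_span ⟨_, ?_, ((congrArg _ (FreeOp.qComp_cls _ _ _ _)).trans
        (FreeOp.qAct_cls _ _ _ _)).symm⟩)
    rfl

/-- `collQ` is defined by matching on the arity, so its value is only visible after splitting `n`
into `0`, `1` and `_ + 3`. -/
theorem collQ_subsingleton (k : Type u) [Field k] {n : ℕ} (hn : n ≠ 2)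
    (Z : (Fin n → Sig)ᵒᵖ × Sig) : Subsingleton ((collQ k n).obj Z) := by
  match n, hn, Z with
  | 0, _, _ => exact inferInstanceAs (Subsingleton PUnit)
  | 1, _, _ => exact inferInstanceAs (Subsingleton PUnit)
  | _ + 3, _, _ => exact inferInstanceAs (Subsingleton PUnit)

/-- `ℍ` is by construction a quotient of the required kind, so the comparison morphism is the
identity. -/
theorem hyperoperad_isBinaryQuadratic (k : Type u) [Field k] :
    IsBinaryQuadratic.{u} (hyperoperad k) :=
  ⟨collQ k, fun L c => {x | Associator k L c x},
    fun _ hn _ _ => collQ_subsingleton k hn _, fun _ _ _ h => h.mem_weightPart,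
    COperad.Hom.refl _, fun _ _ => Function.bijective_id⟩

/-! ### Generators of the hyperoperad -/

section
variable {k : Type u} [Field k]

/-- The class of a scheme in `Q`. -/
def schemeQ (k : Type u) [Field k] {c : Fin 2 → Sig} {d : Sig} (s : Scheme (c 0) (c 1) d) :
    (collQ k 2).obj (op c, d) :=
  Submodule.Quotient.mk (p := relSub (genX k) (EqPair k) (op c, d))
    (Finsupp.single s (1 : k) : Scheme (c 0) (c 1) d →₀ k)

theorem collQ_map_schemeQ {c c' : Fin 2 → Sig} {d d' : Sig} (φ : c' ⟶ c) (f : d ⟶ d')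
    (s : Scheme (c 0) (c 1) d) :
    ((collQ k 2).map (X := (op c, d)) (Y := (op c', d')) (Prod.mkHom φ.op f)).hom (schemeQ k s) =
      schemeQ k (Scheme.act (φ 0) (φ 1) f s) := by
  refine congrArg (Submodule.Quotient.mk (p := relSub (genX k) (EqPair k) (op c', d'))) ?_
  exact Finsupp.mapDomain_single

theorem schemeQ_eq {n m : ℕ} (i : Fin n) (σ : Equiv.Perm (Fin n)) (τ : Equiv.Perm (Fin m)) :
    schemeQ k (c := ![Sig.mk n, Sig.mk m])
        ⟨n, m, i, Sig.ofPerm σ, Sig.ofPerm τ, 𝟙 (Sig.mk (n + m - 1))⟩ =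
      schemeQ k (c := ![Sig.mk n, Sig.mk m])
        ⟨n, m, σ i, 𝟙 (Sig.mk n), 𝟙 (Sig.mk m), Sig.ofPerm (insertPerm σ i τ)⟩ := by
  -- The generating pair is used as it stands: the morphism of colors in `relSub` is taken to be the
  -- identity, which `map_id` then removes.
  refine (Submodule.Quotient.eq _).2 (Submodule.subset_span ⟨_, 𝟙 _, _, _,
    EqPair.mk i σ τ, ?_⟩)
  rw [CategoryTheory.Functor.map_id]
  rfl

/-- A pair of morphisms of colors as a morphism of lists. -/
def pairHom {c : Fin 2 → Sig} {n m : ℕ} (f : c 0 ⟶ Sig.mk n) (g : c 1 ⟶ Sig.mk m) :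
    c ⟶ ![Sig.mk n, Sig.mk m]
  | 0 => f
  | 1 => g

/-- The three permutations of a scheme are absorbed by the action of `Σ` on `(*ᵢ, 1 1; 1)`. Hence
the classes `[*ᵢ]` generate `Q` as a functor. -/
theorem schemeQ_eq_map {c : Fin 2 → Sig} {d : Sig} (s : Scheme (c 0) (c 1) d) :
    schemeQ k s = ((collQ k 2).map (X := (op ![Sig.mk s.n, Sig.mk s.m], Sig.mk (s.n + s.m - 1)))
      (Y := (op c, d)) (Prod.mkHom (pairHom s.σ s.τ).op s.π)).hom (starQ k s.i) := by
  refine Eq.symm ((collQ_map_schemeQ (pairHom s.σ s.τ) s.π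
    ⟨s.n, s.m, s.i, 𝟙 _, 𝟙 _, 𝟙 _⟩).trans ?_)
  rfl

theorem freeGen_schemeQ {c : Fin 2 → Sig} {d : Sig} (s : Scheme (c 0) (c 1) d) :
    freeGen (collQ k) (schemeQ k s) =
      (freeOperad (collQ k)).coll.act (SymList.ofPi (pairHom s.σ s.τ)) s.π (star k s.i) := by
  rw [schemeQ_eq_map]
  exact (FreeOp.act_freeGen _ _ _).symm

/-- The relation that defines `Q`, with both schemes replaced by actions on classes `[*]` in `F(Q)`.
In this form its evaluation in an algebra is the equivariance axiom. -/
theorem act_star {n m : ℕ} (i : Fin n) (σ : Equiv.Perm (Fin n)) (τ : Equiv.Perm (Fin m)) :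
    (freeOperad (collQ k)).coll.act (SymList.ofPi
        (pairHom (c := ![Sig.mk n, Sig.mk m]) (Sig.ofPerm σ) (Sig.ofPerm τ)))
        (𝟙 (Sig.mk (n + m - 1))) (star k i) =
      (freeOperad (collQ k)).coll.act (SymList.ofPi
        (pairHom (c := ![Sig.mk n, Sig.mk m]) (𝟙 (Sig.mk n)) (𝟙 (Sig.mk m))))
        (Sig.ofPerm (insertPerm σ i τ)) (star k (σ i)) := by
  have := congrArg (freeGen (collQ k)) (schemeQ_eq (k := k) i σ τ)
  rwa [freeGen_schemeQ, freeGen_schemeQ] at this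

/-- The linear combinations of schemes as operations of `F(Q)`. -/
def schemeLin (k : Type u) [Field k] (c : Fin 2 → Sig) (d : Sig) :
    (Scheme (c 0) (c 1) d →₀ k) →ₗ[k] (freeOperad (collQ k)).coll.sp ⟨2, c⟩ d :=
  (FreeOp.genLin (collQ k) c d).comp (Submodule.mkQ (relSub (genX k) (EqPair k) (op c, d)))

/-- A family of subspaces of `F(Q)` that contains the classes `[*ᵢ]` and is closed under the
operations contains everything. -/
theorem generated_star
    {p : ∀ (L : SymList Sig) (c : Sig), (freeOperad (collQ k)).coll.sp L c → Prop}
    (h0 : ∀ L c, p L c 0) (hadd : ∀ L c x y, p L c x → p L c y → p L c (x + y))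
    (hsmul : ∀ L c (a : k) x, p L c x → p L c (a • x))
    (hstar : ∀ {n m : ℕ} (i : Fin n), p (colors n m) (Sig.mk (n + m - 1)) (star k i))
    (hact : ∀ {L L' : SymList Sig} {c c' : Sig} (φ : L' ⟶ L) (f : c ⟶ c') (x),
      p L c x → p L' c' ((freeOperad (collQ k)).coll.act φ f x))
    (hcomp : ∀ {L M : SymList Sig} {c : Sig} (i : Fin L.len) (x y), p L c x → p M (L.obj i) y →
      p (L.splice i M) c ((freeOperad (collQ k)).comp i x y))
    {L : SymList Sig} {c : Sig} (x : (freeOperad (collQ k)).coll.sp L c) : p L c x := by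
  refine FreeOp.generated h0 hadd hsmul (fun n c d x => ?_) hact hcomp x
  -- Only arity two carries generators. There an element of `Q` lifts to a linear combination of
  -- schemes, each of which is an action on some `[*ᵢ]`; in all other arities `Q` is zero.
  by_cases hn : n = 2
  · subst hn
    obtain ⟨x, rfl⟩ := Submodule.Quotient.mk_surjective (relSub (genX k) (EqPair k) (op c, d)) x
    change p _ _ (schemeLin k c d x)
    induction x using Finsupp.induction_linear with
    | zero =>
      rw [map_zero]
      exact h0 _ _
    | add x y hx hy =>
      rw [map_add]
      exact hadd _ _ _ _ hx hy
    | single s a =>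
      have : (Finsupp.single s a : Scheme (c 0) (c 1) d →₀ k) = a • Finsupp.single s 1 := by simp
      rw [this, map_smul]
      refine hsmul _ _ _ _ ?_
      change p _ _ (freeGen (collQ k) (schemeQ k s))
      rw [freeGen_schemeQ]
      exact hact _ _ _ (hstar _)
  · have := collQ_subsingleton k hn (op c, d)
    change p _ _ (FreeOp.genLin (collQ k) c d x)
    rw [Subsingleton.elim x 0, map_zero]
    exact h0 _ _

/-- The analogue of `generated_star` for the hyperoperad. -/
theorem hyperoperad_generated
    {p : ∀ (L : SymList Sig) (c : Sig), (hyperoperad k).coll.sp L c → Prop}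
    (h0 : ∀ L c, p L c 0) (hadd : ∀ L c x y, p L c x → p L c y → p L c (x + y))
    (hsmul : ∀ L c (a : k) x, p L c x → p L c (a • x))
    (hstar : ∀ {n m : ℕ} (i : Fin n), p (colors n m) (Sig.mk (n + m - 1)) (starH k i))
    (hact : ∀ {L L' : SymList Sig} {c c' : Sig} (φ : L' ⟶ L) (f : c ⟶ c') (x),
      p L c x → p L' c' ((hyperoperad k).coll.act φ f x))
    (hcomp : ∀ {L M : SymList Sig} {c : Sig} (i : Fin L.len) (x y), p L c x → p M (L.obj i) y →
      p (L.splice i M) c ((hyperoperad k).comp i x y))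
    {L : SymList Sig} {c : Sig} (x : (hyperoperad k).coll.sp L c) : p L c x := by
  obtain ⟨x, rfl⟩ := (idealAs k).cls_surj x
  exact generated_star (p := fun L c x => p L c ((idealAs k).cls x)) (fun L c => h0 L c)
    (fun L c x y => hadd L c _ _) (fun L c a x => hsmul L c a _) hstar
    (fun φ f x => hact φ f _) (fun i x y => hcomp i _ _) x

end

/-! ### From algebras of the hyperoperad to Markl operads -/

section
variable {k : Type u} [Field k] (M : Sig ⥤ ModuleCat.{v} k)

theorem pairArg_update_zero {n m : ℕ} (x x' : M.obj ⟨n⟩)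
    (y : M.obj ⟨m⟩) :
    Function.update (pairArg M x y) (0 : Fin 2) x' = pairArg M x' y := by
  funext r
  match r with
  | ⟨0, _⟩ => rfl
  | ⟨1, _⟩ => rfl

theorem pairArg_update_one {n m : ℕ} (x : M.obj ⟨n⟩)
    (y y' : M.obj ⟨m⟩) :
    Function.update (pairArg M x y) (1 : Fin 2) y' = pairArg M x y' := by
  funext r
  match r with
  | ⟨0, _⟩ => rfl
  | ⟨1, _⟩ => rfl

/-- A multilinear map of two arguments as a bilinear map. -/
def bilinOfPair {n m : ℕ} {c : Sig} (F : EndOp.Sp M (colors n m) c) :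
    M.obj ⟨n⟩ →ₗ[k] M.obj ⟨m⟩ →ₗ[k] M.obj c :=
  LinearMap.mk₂ k (fun x y => F (pairArg M x y))
    (fun x x' y => by
      -- All pairs involved are written as updates of one base pair at one place, the form in which
      -- multilinearity is stated.
      have h := fun z => pairArg_update_zero M x z y
      rw [← h x, ← h x', ← h (x + x')]
      exact F.map_update_add _ _ _ _)
    (fun a x y => by
      have h := fun z => pairArg_update_zero M x z y
      rw [← h x, ← h (a • x)]
      exact F.map_update_smul _ _ _ _)
    (fun x y y' => by
      have h := fun z => pairArg_update_one M x y z
      rw [← h y, ← h y', ← h (y + y')]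
      exact F.map_update_add _ _ _ _)
    (fun a x y => by
      have h := fun z => pairArg_update_one M x y z
      rw [← h y, ← h (a • y)]
      exact F.map_update_smul _ _ _ _)

/-- The triple `(x, y, z)` as a family indexed by the inputs of `[*] ∘₁ [*]`. -/
def tripleArg {n m l : ℕ} (x : M.obj ⟨n⟩) (y : M.obj ⟨m⟩) (z : M.obj ⟨l⟩) :
    ∀ r : Fin ((colors (n + m - 1) l).splice 0 (colors n m)).len,
      M.obj (((colors (n + m - 1) l).splice 0 (colors n m)).obj r)
  | ⟨0, _⟩ => x
  | ⟨1, _⟩ => y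
  | ⟨2, _⟩ => z

/-- The triple `(x, y, z)` as a family indexed by the inputs of `[*] ∘₂ [*]`. -/
def tripleArg' {n m l : ℕ} (x : M.obj ⟨n⟩) (y : M.obj ⟨m⟩) (z : M.obj ⟨l⟩) :
    ∀ r : Fin ((colors n (m + l - 1)).splice 1 (colors m l)).len,
      M.obj (((colors n (m + l - 1)).splice 1 (colors m l)).obj r)
  | ⟨0, _⟩ => x
  | ⟨1, _⟩ => y
  | ⟨2, _⟩ => z

theorem eq_pairArg {n m : ℕ} (a : ∀ r : Fin (colors n m).len, M.obj ((colors n m).obj r)) :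
    a = pairArg M (a 0) (a 1) := by
  funext r
  match r with
  | ⟨0, _⟩ => rfl
  | ⟨1, _⟩ => rfl

theorem eq_tripleArg {n m l : ℕ} (a : ∀ r, M.obj (((colors (n + m - 1) l).splice 0
    (colors n m)).obj r)) :
    a = tripleArg M (a (0 : Fin 3)) (a (1 : Fin 3)) (a (2 : Fin 3)) := by
  funext r
  match r with
  | ⟨0, _⟩ => rfl
  | ⟨1, _⟩ => rfl
  | ⟨2, _⟩ => rfl

/-! ### Composites of two binary operations, evaluated on triples -/

theorem innerArg_left {n m l : ℕ} (x : M.obj ⟨n⟩) (y : M.obj ⟨m⟩) (z : M.obj ⟨l⟩) :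
    EndOp.innerArg M (L := colors (n + m - 1) l) 0 (colors n m) (tripleArg M x y z) =
      pairArg M x y := by
  funext r
  match r with
  | ⟨0, _⟩ => exact EndOp.ev_cast_self M _ _
  | ⟨1, _⟩ => exact EndOp.ev_cast_self M _ _

theorem outerArg_left {n m l : ℕ} (x : M.obj ⟨n⟩) (y : M.obj ⟨m⟩) (z : M.obj ⟨l⟩)
    (a : M.obj ⟨n + m - 1⟩) :
    EndOp.outerArg M (L := colors (n + m - 1) l) 0 (colors n m) (tripleArg M x y z) a =
      pairArg M a z := by
  refine EndOp.outerArg_eq M _ _ _ _ _ rfl fun p hp => ?_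
  match p, hp with
  | ⟨0, _⟩, hp => exact absurd rfl hp
  | ⟨1, _⟩, _ => exact (EndOp.ev_cast_self M _ _).symm

theorem innerArg_right {n m l : ℕ} (x : M.obj ⟨n⟩) (y : M.obj ⟨m⟩) (z : M.obj ⟨l⟩) :
    EndOp.innerArg M (L := colors n (m + l - 1)) 1 (colors m l) (tripleArg' M x y z) =
      pairArg M y z := by
  funext r
  match r with
  | ⟨0, _⟩ => exact EndOp.ev_cast_self M _ _
  | ⟨1, _⟩ => exact EndOp.ev_cast_self M _ _

theorem outerArg_right {n m l : ℕ} (x : M.obj ⟨n⟩) (y : M.obj ⟨m⟩) (z : M.obj ⟨l⟩)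
    (a : M.obj ⟨m + l - 1⟩) :
    EndOp.outerArg M (L := colors n (m + l - 1)) 1 (colors m l) (tripleArg' M x y z) a =
      pairArg M x a := by
  refine EndOp.outerArg_eq M _ _ _ _ _ rfl fun p hp => ?_
  match p, hp with
  | ⟨0, _⟩, _ => exact (EndOp.ev_cast_self M _ _).symm
  | ⟨1, _⟩, hp => exact absurd rfl hp

/-- The colors at corresponding places agree definitionally, so the transports inside `tauHom` are
along `rfl` and only the exchange of two places remains. -/
theorem moveArg_tauHom {n m l : ℕ} (x : M.obj ⟨n⟩) (y : M.obj ⟨m⟩) (z : M.obj ⟨l⟩) :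
    EndOp.moveArg M (tauHom n m l) (tripleArg M x y z) = tripleArg M x z y := by
  refine EndOp.moveArg_eq M _ _ _ fun r => ?_
  match r with
  | ⟨0, _⟩ => exact (EndOp.ev_cast_self M (a := Sig.mk n) rfl _).symm
  | ⟨1, _⟩ => exact (EndOp.ev_cast_self M (a := Sig.mk m) rfl _).symm
  | ⟨2, _⟩ => exact (EndOp.ev_cast_self M (a := Sig.mk l) rfl _).symm

/-- The spliced lists of `[*] ∘₁ [*]` and `[*] ∘₂ [*]` agree definitionally only entry by entry.
This is why there are two kinds of triples, and `assocHom` passes between them. -/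
theorem moveArg_assocHom {n m l : ℕ} (x : M.obj ⟨n⟩) (y : M.obj ⟨m⟩) (z : M.obj ⟨l⟩) :
    EndOp.moveArg M (assocHom n m l) (tripleArg M x y z) = tripleArg' M x y z := by
  refine EndOp.moveArg_eq M _ _ _ fun r => ?_
  match r with
  | ⟨0, _⟩ => exact (EndOp.ev_cast_self M (a := Sig.mk n) rfl _).symm
  | ⟨1, _⟩ => exact (EndOp.ev_cast_self M (a := Sig.mk m) rfl _).symm
  | ⟨2, _⟩ => exact (EndOp.ev_cast_self M (a := Sig.mk l) rfl _).symm

theorem moveArg_pairHom {n m n' m' : ℕ} (f : Sig.mk n' ⟶ Sig.mk n) (g : Sig.mk m' ⟶ Sig.mk m)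
    (x : M.obj ⟨n'⟩) (y : M.obj ⟨m'⟩) :
    EndOp.moveArg M (SymList.ofPi (pairHom (c := ![Sig.mk n', Sig.mk m']) f g))
      (pairArg M x y) = pairArg M (EndOp.ev M f x) (EndOp.ev M g y) := by
  refine EndOp.moveArg_eq M _ _ _ fun r => ?_
  match r with
  | ⟨0, _⟩ => rfl
  | ⟨1, _⟩ => rfl

theorem comp_left_apply {n m l : ℕ} {c : Sig} (F : EndOp.Sp M (colors (n + m - 1) l) c)
    (G : EndOp.Sp M (colors n m) (Sig.mk (n + m - 1))) (x : M.obj ⟨n⟩) (y : M.obj ⟨m⟩)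
    (z : M.obj ⟨l⟩) :
    EndOp.comp M (L := colors (n + m - 1) l) (M := colors n m) 0 F G (tripleArg M x y z) =
      F (pairArg M (G (pairArg M x y)) z) :=
  congrArg F ((outerArg_left M x y z _).trans
    (congrArg (fun b => pairArg M (G b) z) (innerArg_left M x y z)))

theorem comp_right_apply {n m l : ℕ} {c : Sig} (F : EndOp.Sp M (colors n (m + l - 1)) c)
    (G : EndOp.Sp M (colors m l) (Sig.mk (m + l - 1))) (x : M.obj ⟨n⟩) (y : M.obj ⟨m⟩)
    (z : M.obj ⟨l⟩) :
    EndOp.comp M (L := colors n (m + l - 1)) (M := colors m l) 1 F G (tripleArg' M x y z) =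
      F (pairArg M x (G (pairArg M y z))) :=
  congrArg F ((outerArg_right M x y z _).trans
    (congrArg (fun b => pairArg M x (G b)) (innerArg_right M x y z)))

/-- The Markl axioms identify arities by a cast on one side, the associators by `castHom` on the
other side. This cancellation removes both when an axiom is extracted from an associator. -/
theorem Sig.cast_cast {a b : ℕ} (h : a = b) (h' : b = a) (x : M.obj ⟨b⟩) :
    Sig.cast M h (EndOp.ev M (Sig.castHom h') x) = x := by
  subst h
  have : Sig.castHom h' = 𝟙 _ := rfl
  rw [this, EndOp.ev_id]
  exact EndOp.ev_id M x

end

/-! ### The defining relations of `ℍ` on the classes `[*ᵢ]` -/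

theorem starH_act {k : Type u} [Field k] {n m : ℕ} (i : Fin n) (σ : Equiv.Perm (Fin n))
    (τ : Equiv.Perm (Fin m)) :
    (hyperoperad k).coll.act (SymList.ofPi
        (pairHom (c := ![Sig.mk n, Sig.mk m]) (Sig.ofPerm σ) (Sig.ofPerm τ)))
        (𝟙 (Sig.mk (n + m - 1))) (starH k i) =
      (hyperoperad k).coll.act (SymList.ofPi
        (pairHom (c := ![Sig.mk n, Sig.mk m]) (𝟙 (Sig.mk n)) (𝟙 (Sig.mk m))))
        (Sig.ofPerm (insertPerm σ i τ)) (starH k (σ i)) :=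
  congrArg (idealAs k).cls (act_star i σ τ)

theorem starH_par {k : Type u} [Field k] {n m l : ℕ} (j p : Fin n) (h : p ≠ j) :
    (hyperoperad k).comp (L := colors (n + m - 1) l) (M := colors n m) 0
        (starH k (outer m j p h)) (starH k j) =
      (hyperoperad k).coll.act (tauHom n m l) (Sig.castHom (par_len m l j p h).symm)
        ((hyperoperad k).comp (L := colors (n + l - 1) m) (M := colors n l) 0
          (starH k (outer l p j h.symm)) (starH k p)) :=
  (Submodule.Quotient.eq _).2 (COperad.Ideal.subset_span (Associator.par j p h))

theorem starH_seq {k : Type u} [Field k] {n m l : ℕ} (j : Fin n) (q : Fin m) :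
    (hyperoperad k).comp (L := colors (n + m - 1) l) (M := colors n m) 0
        (starH k (inner j q)) (starH k j) =
      (hyperoperad k).coll.act (assocHom n m l) (Sig.castHom (seq_len l j q).symm)
        ((hyperoperad k).comp (L := colors n (m + l - 1)) (M := colors m l) 1
          (starH k j) (starH k q)) :=
  (Submodule.Quotient.eq _).2 (COperad.Ideal.subset_span (Associator.seq j q))

/-! ### Evaluation of these relations in an algebra -/

namespace COperad.Algebra

section
variable {k : Type u} [Field k] (A : COperad.Algebra.{u, v} (hyperoperad k))

theorem eval_act {P : COperad.{w} k Sig} (A : COperad.Algebra.{w, v} P) {L L' : SymList Sig}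
    {c c' : Sig} (φ : L' ⟶ L) (f : c ⟶ c') (x : P.coll.sp L c)
    (a : ∀ j, A.obj.obj (L'.obj j)) :
    A.eval (P.coll.act φ f x) a = EndOp.ev A.obj f (A.eval x (EndOp.moveArg A.obj φ a)) := by
  rw [eval, A.str.app_act]
  rfl

theorem eval_comp {P : COperad.{w} k Sig} (A : COperad.Algebra.{w, v} P) {L M : SymList Sig}
    {c : Sig} (i : Fin L.len) (x : P.coll.sp L c) (y : P.coll.sp M (L.obj i)) :
    A.eval (P.comp i x y) = EndOp.comp A.obj i (A.eval x) (A.eval y) :=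
  A.str.app_comp i x y

theorem eval_act_pair {P : COperad.{w} k Sig} (A : COperad.Algebra.{w, v} P) {n m n' m' : ℕ}
    {c c' : Sig} (f : Sig.mk n' ⟶ Sig.mk n) (g : Sig.mk m' ⟶ Sig.mk m) (h : c ⟶ c')
    (X : P.coll.sp (colors n m) c) (x : A.obj.obj ⟨n'⟩) (y : A.obj.obj ⟨m'⟩) :
    A.eval (P.coll.act (SymList.ofPi (pairHom (c := ![Sig.mk n', Sig.mk m']) f g)) h X)
        (pairArg A.obj x y) =
      EndOp.ev A.obj h (A.eval X (pairArg A.obj (EndOp.ev A.obj f x) (EndOp.ev A.obj g y))) :=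
  (eval_act A _ h X _).trans (congrArg (fun a => EndOp.ev A.obj h (A.eval X a))
    (moveArg_pairHom A.obj f g x y))

theorem eval_comp_left {P : COperad.{w} k Sig} (A : COperad.Algebra.{w, v} P) {n m l : ℕ}
    {c : Sig} (F : P.coll.sp (colors (n + m - 1) l) c)
    (G : P.coll.sp (colors n m) (Sig.mk (n + m - 1))) (x : A.obj.obj ⟨n⟩) (y : A.obj.obj ⟨m⟩)
    (z : A.obj.obj ⟨l⟩) :
    A.eval (P.comp (L := colors (n + m - 1) l) (M := colors n m) 0 F G)
        (tripleArg A.obj x y z) =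
      A.eval F (pairArg A.obj (A.eval G (pairArg A.obj x y)) z) :=
  (congrArg (fun H : EndOp.Sp A.obj ((colors (n + m - 1) l).splice 0 (colors n m)) c =>
    H (tripleArg A.obj x y z)) (eval_comp A (L := colors (n + m - 1) l) 0 F G)).trans
    (comp_left_apply A.obj _ _ x y z)

theorem eval_comp_right {P : COperad.{w} k Sig} (A : COperad.Algebra.{w, v} P) {n m l : ℕ}
    {c : Sig} (F : P.coll.sp (colors n (m + l - 1)) c)
    (G : P.coll.sp (colors m l) (Sig.mk (m + l - 1))) (x : A.obj.obj ⟨n⟩) (y : A.obj.obj ⟨m⟩)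
    (z : A.obj.obj ⟨l⟩) :
    A.eval (P.comp (L := colors n (m + l - 1)) (M := colors m l) 1 F G)
        (tripleArg' A.obj x y z) =
      A.eval F (pairArg A.obj x (A.eval G (pairArg A.obj y z))) :=
  (congrArg (fun H : EndOp.Sp A.obj ((colors n (m + l - 1)).splice 1 (colors m l)) c =>
    H (tripleArg' A.obj x y z)) (eval_comp A (L := colors n (m + l - 1)) 1 F G)).trans
    (comp_right_apply A.obj _ _ x y z)

/-- The Markl operad structure on the underlying collection of an algebra of the hyperoperad. -/
def marklStr : MarklStr A.obj where
  comp i := bilinOfPair A.obj (A.eval (starH k i))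
  equivariance {n m} σ τ i x y := by
    have h := congrArg (fun F => A.eval F (pairArg A.obj x y)) (starH_act (k := k) i σ τ)
    -- An identity is inserted on the output, so that the left side has the shape of the action in
    -- `starH_act`; that relation is then evaluated at `(x, y)`.
    refine (EndOp.ev_id A.obj _).symm.trans ((eval_act_pair A (Sig.ofPerm σ) (Sig.ofPerm τ) _
      (starH k i) x y).symm.trans (h.trans ((eval_act_pair A _ _ _ _ x y).trans ?_)))
    rw [EndOp.ev_id, EndOp.ev_id]
    rfl
  par_assoc {n m l} j p h x y z := by
    -- The relation `starH_par` is evaluated at `(x, y, z)`. The cast of the axiom cancels the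
    -- identification of outputs in the relation, and `tauHom` turns the triple into `(x, z, y)`.
    refine (congrArg (Sig.cast A.obj (par_len m l j p h)) ((eval_comp_left A _ _ x y z).symm.trans
      ((congrArg (fun F => A.eval F (tripleArg A.obj x y z))
        (starH_par (k := k) (m := m) (l := l) j p h)).trans (eval_act A _ _ _ _)))).trans
      ((Sig.cast_cast _ _ _ _).trans ?_)
    rw [moveArg_tauHom]
    exact eval_comp_left A _ _ x z y
  seq_assoc {n m l} j q x y z := by
    refine (congrArg (Sig.cast A.obj (seq_len l j q)) ((eval_comp_left A _ _ x y z).symm.trans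
      ((congrArg (fun F => A.eval F (tripleArg A.obj x y z))
        (starH_seq (k := k) (m := m) (l := l) j q)).trans (eval_act A _ _ _ _)))).trans
      ((Sig.cast_cast _ _ _ _).trans ?_)
    rw [moveArg_assocHom]
    exact eval_comp_right A _ _ x y z

end

end COperad.Algebra

/-! ### From Markl operads to algebras of the hyperoperad -/

/-- The cancellation opposite to `Sig.cast_cast`, for feeding an associativity axiom into an
associator. -/
theorem Sig.ev_cast {k : Type u} [Field k] (M : Sig ⥤ ModuleCat.{v} k) {a b : ℕ} (h : a = b)
    (h' : b = a) (x : M.obj ⟨a⟩) : EndOp.ev M (Sig.castHom h') (Sig.cast M h x) = x := by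
  subst h
  have : Sig.castHom h' = 𝟙 _ := rfl
  rw [this, EndOp.ev_id]
  exact EndOp.ev_id M x

/-- A bilinear map as a multilinear map of two arguments. -/
def pairOfBilin {k : Type u} [Field k] (M : Sig ⥤ ModuleCat.{v} k) {c : Fin 2 → Sig} {d : Sig}
    (B : M.obj (c 0) →ₗ[k] M.obj (c 1) →ₗ[k] M.obj d) : EndOp.Sp M ⟨2, c⟩ d where
  toFun x := B (x (0 : Fin 2)) (x (1 : Fin 2))
  map_update_add' {inst} x j a b := by
    -- The field quantifies over every decidability instance. With the canonical one, updates at the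
    -- two places reduce by computation.
    have : inst = instDecidableEqFin 2 := Subsingleton.elim _ _
    subst this
    match j with
    | ⟨0, _⟩ => exact LinearMap.map_add₂ B a b (x (1 : Fin 2))
    | ⟨1, _⟩ => exact map_add (B (x (0 : Fin 2))) a b
  map_update_smul' {inst} x j a b := by
    have : inst = instDecidableEqFin 2 := Subsingleton.elim _ _
    subst this
    match j with
    | ⟨0, _⟩ => exact LinearMap.map_smul₂ B a b (x (1 : Fin 2))
    | ⟨1, _⟩ => exact map_smul (B (x (0 : Fin 2))) a b

namespace MarklStr

section
variable {k : Type u} [Field k] {M : Sig ⥤ ModuleCat.{v} k} (S : MarklStr M)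

/-- The operation `(x, y) ↦ ((x σ) ∘ᵢ (y τ)) π`. -/
def schemeOp {c : Fin 2 → Sig} {d : Sig} (s : Scheme (c 0) (c 1) d) : EndOp.Sp M ⟨2, c⟩ d :=
  pairOfBilin M (((S.comp s.i).compl₁₂ (EndOp.ev M s.σ) (EndOp.ev M s.τ)).compr₂ (EndOp.ev M s.π))

/-- The linear extension of `schemeOp`. -/
def schemeLin (c : Fin 2 → Sig) (d : Sig) :
    (Scheme (c 0) (c 1) d →₀ k) →ₗ[k] EndOp.Sp M ⟨2, c⟩ d :=
  Finsupp.linearCombination k S.schemeOp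

theorem schemeLin_single {c : Fin 2 → Sig} {d : Sig} (s : Scheme (c 0) (c 1) d) :
    S.schemeLin c d (Finsupp.single s 1) = S.schemeOp s := by
  simp [schemeLin]

/-- By functoriality of `M`, the acting permutations compose with those of the scheme. This
naturality in the colors is what `FreeOp.lift` asks of the values on generators. -/
theorem act_schemeOp {c c' : Fin 2 → Sig} {d d' : Sig} (φ : c' ⟶ c) (f : d ⟶ d')
    (s : Scheme (c 0) (c 1) d) :
    EndOp.act M (SymList.ofPi φ) f (S.schemeOp s) =
      S.schemeOp (Scheme.act (φ 0) (φ 1) f s) := by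
  refine MultilinearMap.ext fun x => ?_
  have h0 := EndOp.moveArg_perm M (SymList.ofPi φ) x (0 : Fin 2)
  have h1 := EndOp.moveArg_perm M (SymList.ofPi φ) x (1 : Fin 2)
  refine (congrArg (fun a => EndOp.ev M f (EndOp.ev M s.π a))
    (congrArg₂ (fun a b => S.comp s.i (EndOp.ev M s.σ a) (EndOp.ev M s.τ b)) h0 h1)).trans ?_
  refine (EndOp.ev_ev M _ _ _).trans ?_
  exact congrArg (EndOp.ev M (s.π ≫ f)) (congrArg₂ (fun a b => S.comp s.i a b)
    (EndOp.ev_ev M _ _ _) (EndOp.ev_ev M _ _ _))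

theorem act_schemeLin {c c' : Fin 2 → Sig} {d d' : Sig} (φ : c' ⟶ c) (f : d ⟶ d')
    (x : Scheme (c 0) (c 1) d →₀ k) :
    EndOp.act M (SymList.ofPi φ) f (S.schemeLin c d x) =
      S.schemeLin c' d' (Finsupp.mapDomain (Scheme.act (φ 0) (φ 1) f) x) := by
  induction x using Finsupp.induction_linear with
  | zero => simp
  | add x y hx hy => rw [map_add, map_add, hx, hy, Finsupp.mapDomain_add, map_add]
  | single s a => simp [schemeLin, act_schemeOp, Finsupp.mapDomain_single]

/-- Up to actions of identities, the two schemes give `(x σ) ∘ᵢ (y τ)` and `(x ∘_{σ(i)} y)(σ ∘ᵢ τ)`,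
which the equivariance axiom equates. -/
theorem schemeLin_eqPair {Z : (Fin 2 → Sig)ᵒᵖ × Sig} {a b : (genX k).obj Z}
    (h : EqPair k Z a b) : S.schemeLin Z.1.unop Z.2 a = S.schemeLin Z.1.unop Z.2 b := by
  cases h with
  | @mk n m i σ τ =>
    refine (S.schemeLin_single (c := ![Sig.mk n, Sig.mk m]) _).trans (Eq.trans ?_
      (S.schemeLin_single (c := ![Sig.mk n, Sig.mk m]) _).symm)
    refine MultilinearMap.ext fun x => ?_
    refine (EndOp.ev_id M _).trans ((S.equivariance σ τ i (x (0 : Fin 2)) (x (1 : Fin 2))).trans ?_)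
    exact congrArg (EndOp.ev M (Sig.ofPerm (insertPerm σ i τ)))
      (congrArg₂ (fun a b => S.comp (σ i) a b)
        (EndOp.ev_id M _).symm (EndOp.ev_id M _).symm)

/-- The operations on a Markl operad given by the elements of `X`. -/
def genXLin (c : Fin 2 → Sig) (d : Sig) : (genX k).obj (op c, d) →ₗ[k] EndOp.Sp M ⟨2, c⟩ d :=
  S.schemeLin c d

theorem relSub_le_ker (c : Fin 2 → Sig) (d : Sig) :
    relSub (genX k) (EqPair k) (op c, d) ≤ LinearMap.ker (S.genXLin c d) := by
  refine Submodule.span_le.2 ?_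
  rintro _ ⟨Z, f, a, b, h, rfl⟩
  refine LinearMap.mem_ker.2 ?_
  -- A spanning element is the image of `a - b`, for a related pair, under a morphism of colors. By
  -- naturality this morphism comes out as an action on multilinear maps, so only `a - b` itself has
  -- to be sent to zero.
  have e := S.act_schemeLin (c := Z.1.unop) (c' := c) f.1.unop f.2 (a - b)
  refine e.symm.trans ?_
  have e' : S.schemeLin Z.1.unop Z.2 (a - b) = 0 :=
    (map_sub (S.schemeLin Z.1.unop Z.2) a b).trans (sub_eq_zero.2 (S.schemeLin_eqPair h))
  exact (congrArg _ e').trans (map_zero _)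

/-- The operations on a Markl operad given by the elements of `Q`. -/
def genOp : ∀ (n : ℕ) (c : Fin n → Sig) (d : Sig),
    (collQ k n).obj (op c, d) →ₗ[k] (endOperad M).coll.sp ⟨n, c⟩ d
  | 2, c, d => (relSub (genX k) (EqPair k) (op c, d)).liftQ (S.genXLin c d) (S.relSub_le_ker c d)
  | 0, _, _ => 0
  | 1, _, _ => 0
  | _ + 3, _, _ => 0

theorem act_genOp {n : ℕ} {c c' : Fin n → Sig} {d d' : Sig} (φ : c' ⟶ c) (f : d ⟶ d')
    (x : (collQ k n).obj (op c, d)) :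
    (endOperad M).coll.act (SymList.ofPi φ) f (S.genOp n c d x) =
      S.genOp n c' d' (((collQ k n).map (X := (op c, d)) (Y := (op c', d'))
        (Prod.mkHom φ.op f)).hom x) := by
  by_cases hn : n = 2
  · subst hn
    obtain ⟨x, rfl⟩ := Submodule.Quotient.mk_surjective (relSub (genX k) (EqPair k) (op c, d)) x
    exact S.act_schemeLin φ f x
  · have := collQ_subsingleton k hn (op c, d)
    rw [Subsingleton.elim x 0]
    simp only [map_zero]

/-- The action of the free operad on a Markl operad. -/
def freeHom : COperad.Hom (freeOperad (collQ k)) (endOperad M) :=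
  FreeOp.lift S.genOp fun φ f x => S.act_genOp φ f x

/-- The action of `[*ᵢ]` on a Markl operad. -/
def starOp {n m : ℕ} (i : Fin n) : EndOp.Sp M (colors n m) (Sig.mk (n + m - 1)) :=
  S.freeHom.app (colors n m) _ (star k i)

/-- `[*ᵢ]` is the class of the scheme with three identity permutations, and its operation is `∘ᵢ`
once the actions of identities are removed. -/
theorem starOp_apply {n m : ℕ} (i : Fin n) (x : M.obj ⟨n⟩) (y : M.obj ⟨m⟩) :
    S.starOp i (pairArg M x y) = S.comp i x y := by
  have h : S.starOp i =
      S.schemeOp (c := ![Sig.mk n, Sig.mk m]) ⟨n, m, i, 𝟙 _, 𝟙 _, 𝟙 _⟩ :=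
    (FreeOp.lift_freeGen S.genOp _ (starQ k i)).trans
      (S.schemeLin_single (c := ![Sig.mk n, Sig.mk m]) _)
  refine (congrArg (fun F : EndOp.Sp M (colors n m) _ => F (pairArg M x y)) h).trans ?_
  exact (EndOp.ev_id M _).trans (congrArg₂ (fun a b => S.comp i a b)
      (EndOp.ev_id M _) (EndOp.ev_id M _))

theorem comp_left_star {n m l : ℕ} (i : Fin (n + m - 1)) (j : Fin n) (x : M.obj ⟨n⟩)
    (y : M.obj ⟨m⟩) (z : M.obj ⟨l⟩) :
    (EndOp.comp M (L := colors (n + m - 1) l) (M := colors n m) 0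
      (S.starOp i) (S.starOp j)) (tripleArg M x y z) =
      S.comp i (S.comp j x y) z := by
  refine (comp_left_apply M _ _ x y z).trans ((S.starOp_apply i _ z).trans ?_)
  exact congrArg (fun a => S.comp i a z) (S.starOp_apply j x y)

theorem comp_right_star {n m l : ℕ} (i : Fin n) (j : Fin m) (x : M.obj ⟨n⟩)
    (y : M.obj ⟨m⟩) (z : M.obj ⟨l⟩) :
    (EndOp.comp M (L := colors n (m + l - 1)) (M := colors m l) 1
      (S.starOp i) (S.starOp j)) (tripleArg' M x y z) =
      S.comp i x (S.comp j y z) := by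
  refine (comp_right_apply M _ _ x y z).trans ((S.starOp_apply i x _).trans ?_)
  exact congrArg (fun a => S.comp i x a) (S.starOp_apply j y z)

/-- On triples, a `par` associator acts as the difference of the two sides of parallel
associativity, and a `seq` associator as that of sequential associativity. Since the kernel of
`freeHom` is an ideal, it then contains all of `As`. -/
theorem freeHom_associator {L : SymList Sig} {c : Sig} {x : (freeOperad (collQ k)).coll.sp L c}
    (h : Associator k L c x) : S.freeHom.app L c x = 0 := by
  cases h with
  | @par n m l j p h =>
    rw [map_sub, sub_eq_zero, COperad.Hom.app_act]
    refine (S.freeHom.app_comp _ _ _).trans (Eq.trans ?_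
      (congrArg _ (S.freeHom.app_comp _ _ _).symm))
    refine MultilinearMap.ext fun a => ?_
    rw [eq_tripleArg M a]
    generalize a (0 : Fin 3) = x
    generalize a (1 : Fin 3) = y
    generalize a (2 : Fin 3) = z
    refine (S.comp_left_star _ _ _ _ _).trans (Eq.symm ((EndOp.act_apply M _ _ _ _).trans ?_))
    -- On the triple reordered by `tauHom` the composite is `(x ∘ₚ z) ∘ y`. The axiom replaces it by
    -- the cast of `(x ∘ⱼ y) ∘ z`, and the identification of outputs in the associator undoes this
    -- cast.
    refine (congrArg (EndOp.ev M _) (((congrArg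
      (fun b => EndOp.comp M (L := colors (n + l - 1) m) (M := colors n l) 0
      (S.starOp (outer l p j h.symm)) (S.starOp p) b) (moveArg_tauHom M x y z)).trans
      (S.comp_left_star _ _ _ _ _)).trans
      (S.par_assoc j p h _ _ _).symm)).trans ?_
    exact Sig.ev_cast M (par_len m l j p h) (par_len m l j p h).symm _
  | @seq n m l j q =>
    rw [map_sub, sub_eq_zero, COperad.Hom.app_act]
    refine (S.freeHom.app_comp _ _ _).trans (Eq.trans ?_
      (congrArg _ (S.freeHom.app_comp _ _ _).symm))
    refine MultilinearMap.ext fun a => ?_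
    rw [eq_tripleArg M a]
    generalize a (0 : Fin 3) = x
    generalize a (1 : Fin 3) = y
    generalize a (2 : Fin 3) = z
    refine (S.comp_left_star _ _ _ _ _).trans (Eq.symm ((EndOp.act_apply M _ _ _ _).trans ?_))
    refine (congrArg (EndOp.ev M _) (((congrArg
      (fun b => EndOp.comp M (L := colors n (m + l - 1)) (M := colors m l) 1
      (S.starOp j) (S.starOp q) b) (moveArg_assocHom M x y z)).trans
      (S.comp_right_star _ _ _ _ _)).trans
      (S.seq_assoc j q _ _ _).symm)).trans ?_
    exact Sig.ev_cast M (seq_len l j q) (seq_len l j q).symm _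

/-- The action of the hyperoperad on a Markl operad. -/
def hyperHom : COperad.Hom (hyperoperad k) (endOperad M) :=
  (idealAs k).liftQuot S.freeHom fun L c =>
    COperad.Ideal.span_le (I := S.freeHom.ker) (fun _ _ _ h => S.freeHom_associator h) L c

/-- A Markl operad as an algebra of the hyperoperad. -/
def algebra : COperad.Algebra.{u, v} (hyperoperad k) := ⟨M, S.hyperHom⟩

theorem algebra_eval_starH {n m : ℕ} (i : Fin n) (x : M.obj ⟨n⟩) (y : M.obj ⟨m⟩) :
    S.algebra.eval (starH k i) (pairArg M x y) = S.comp i x y :=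
  S.starOp_apply i x y

/-- A Markl structure is determined by its partial compositions, and these are recovered as the
action of the `[*ᵢ]`. -/
theorem marklStr_algebra : S.algebra.marklStr = S := by
  refine MarklStr.ext ?_
  funext n m i
  exact LinearMap.ext₂ fun x y => S.algebra_eval_starH i x y

end

end MarklStr

/-! ### The isomorphism of categories -/

namespace COperad.Algebra

section
variable {k : Type u} [Field k]

/-- Morphisms of algebras of the hyperoperad are the natural transformations that are compatible
with the operations `[*ᵢ]`. -/
theorem nat_eval_of_starH {A B : COperad.Algebra.{u, v} (hyperoperad k)} (F : A.obj ⟶ B.obj)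
    (h : ∀ {n m : ℕ} (i : Fin n) (x : A.obj.obj ⟨n⟩) (y : A.obj.obj ⟨m⟩),
      (F.app ⟨n + m - 1⟩).hom (A.eval (starH k i) (pairArg A.obj x y)) =
        B.eval (starH k i) (pairArg B.obj ((F.app ⟨n⟩).hom x) ((F.app ⟨m⟩).hom y)))
    {L : SymList Sig} {c : Sig} (x : (hyperoperad k).coll.sp L c)
    (a : ∀ j, A.obj.obj (L.obj j)) :
    (F.app c).hom (A.eval x a) = B.eval x fun j => (F.app (L.obj j)).hom (a j) := by
  have nat : ∀ {c d : Sig} (f : c ⟶ d) (x : A.obj.obj c),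
      (F.app d).hom (EndOp.ev A.obj f x) = EndOp.ev B.obj f ((F.app c).hom x) := by
    intro c d f x
    exact congrArg (fun g => g.hom x) (F.naturality f)
  -- The induction changes the list of inputs, so the property must quantify over the arguments.
  revert a
  refine hyperoperad_generated (p := fun L c x => ∀ a, (F.app c).hom (A.eval x a) =
    B.eval x fun j => (F.app (L.obj j)).hom (a j)) ?_ ?_ ?_ ?_ ?_ ?_ x
  · intro L c a
    simp only [eval, map_zero]
    exact map_zero _
  · intro L c x y hx hy a
    have e : ∀ (A : COperad.Algebra.{u, v} (hyperoperad k)), A.eval (x + y) = A.eval x + A.eval y :=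
      fun A => map_add (A.str.app L c) x y
    rw [e, e, add_apply, add_apply, map_add, hx, hy]
  · intro L c r x hx a
    have e : ∀ (A : COperad.Algebra.{u, v} (hyperoperad k)), A.eval (r • x) = r • A.eval x :=
      fun A => map_smul (A.str.app L c) r x
    rw [e, e, smul_apply, smul_apply, map_smul, hx]
  · intro n m i a
    rw [eq_pairArg A.obj a]
    refine (h i _ _).trans (congrArg _ ?_)
    exact (eq_pairArg B.obj fun j => (F.app ((colors n m).obj j)).hom
      (pairArg A.obj (a (0 : Fin 2)) (a (1 : Fin 2)) j)).symm
  · intro L L' c c' φ f x hx a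
    -- Actions are respected because `F` is natural, in the output color and along each component of
    -- `φ`.
    rw [eval_act, eval_act, nat, hx]
    exact congrArg (fun b => EndOp.ev B.obj f (B.eval x b)) (funext fun j => nat _ _)
  · intro L M c i x y hx hy a
    rw [eval_comp, eval_comp, EndOp.comp_apply, EndOp.comp_apply, hx]
    -- It remains to compare the arguments of the outer operation: at the place `i` this is the
    -- induction hypothesis for `y`, at the other places naturality of `F`.
    refine congrArg _ (Eq.symm ?_)
    refine EndOp.outerArg_eq B.obj i M _ _ _ ?_ ?_
    · rw [EndOp.outerArg_self, hy]
      exact congrArg _ (funext fun q => nat _ _)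
    · intro p hp
      rw [EndOp.outerArg_ne A.obj i M a _ hp, nat]

/-- The identity of `M` is viewed as a comparison of two algebra structures. Its compatibility with
the `[*ᵢ]`, given by the equality of Markl structures, spreads to all operations by
`nat_eval_of_starH`. -/
theorem ext_marklStr {M : Sig ⥤ ModuleCat.{v} k} (f g : COperad.Hom (hyperoperad k) (endOperad M))
    (h : marklStr ⟨M, f⟩ = marklStr ⟨M, g⟩) : f = g := by
  refine COperad.Hom.ext ?_
  funext L c
  refine LinearMap.ext fun x => MultilinearMap.ext fun a => ?_
  refine nat_eval_of_starH (A := ⟨M, f⟩) (B := ⟨M, g⟩) (𝟙 M) (fun {n m} i x y => ?_) x a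
  exact congrArg (fun S : MarklStr M => S.comp i x y) h

/-- Both algebras have the same underlying functor, so only the structure morphisms are compared,
and these are detected by their Markl structures. -/
theorem algebra_marklStr (A : COperad.Algebra.{u, v} (hyperoperad k)) :
    A.marklStr.algebra = A := by
  obtain ⟨M, f⟩ := A
  exact congrArg (COperad.Algebra.mk M) (ext_marklStr _ _ (MarklStr.marklStr_algebra _))

/-- For equality of functors, morphisms are compared whose sources and targets agree only
propositionally. The underlying natural transformations decide, and a round trip leaves these
unchanged. -/
theorem hom_heq {P : COperad.{w} k Sig} {A A' B B' : COperad.Algebra.{w, v} P} (hA : A = A')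
    (hB : B = B') (f : A ⟶ B) (f' : A' ⟶ B') (h : HEq (Hom.nat f) (Hom.nat f')) : HEq f f' := by
  subst hA hB
  exact heq_of_eq (Hom.ext (eq_of_heq h))

end

end COperad.Algebra

/-! ### The two functors and their composites -/

/-- The Markl operad of an algebra of the hyperoperad. -/
def toMarkl (k : Type u) [Field k] :
    COperad.Algebra.{u, v} (hyperoperad k) ⥤ MarklOperad.{v} k where
  obj A := ⟨A.obj, A.marklStr⟩
  map {A B} f := ⟨COperad.Algebra.Hom.nat f, fun {n m} i x y => by
    refine (COperad.Algebra.Hom.nat_eval f (starH k i) (pairArg A.obj x y)).trans ?_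
    exact congrArg (B.eval (starH k i)) (eq_pairArg B.obj _)⟩
  map_id _ := rfl
  map_comp _ _ := rfl

/-- The algebra of the hyperoperad given by a Markl operad. -/
def ofMarkl (k : Type u) [Field k] :
    MarklOperad.{v} k ⥤ COperad.Algebra.{u, v} (hyperoperad k) where
  obj O := O.str.algebra
  map {O O'} f := ⟨MarklOperad.Hom.nat f, COperad.Algebra.nat_eval_of_starH (A := O.str.algebra)
    (B := O'.str.algebra) _ fun {n m} i x y => by
      refine (congrArg _ (O.str.algebra_eval_starH i x y)).trans
        ((MarklOperad.Hom.nat_comp f i x y).trans (O'.str.algebra_eval_starH i _ _).symm)⟩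
  map_id _ := rfl
  map_comp _ _ := rfl

theorem toMarkl_ofMarkl (k : Type u) [Field k] :
    toMarkl.{v} k ⋙ ofMarkl.{v} k = 𝟭 _ :=
  Functor.hext (fun A => A.algebra_marklStr) fun A B _ =>
    COperad.Algebra.hom_heq A.algebra_marklStr B.algebra_marklStr _ _ HEq.rfl

theorem MarklOperad.hom_heq {k : Type u} [Field k] {A A' B B' : MarklOperad.{v} k} (hA : A = A')
    (hB : B = B') (f : A ⟶ B) (f' : A' ⟶ B') (h : HEq (Hom.nat f) (Hom.nat f')) : HEq f f' := by
  subst hA hB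
  exact heq_of_eq (Hom.ext (eq_of_heq h))

theorem ofMarkl_toMarkl (k : Type u) [Field k] :
    ofMarkl.{v} k ⋙ toMarkl.{v} k = 𝟭 _ :=
  have h (O : MarklOperad.{v} k) : (⟨O.coll, O.str.algebra.marklStr⟩ : MarklOperad k) = O :=
    congrArg (MarklOperad.mk O.coll) O.str.marklStr_algebra
  Functor.hext h fun A B _ => MarklOperad.hom_heq (h A) (h B) _ _ HEq.rfl

end

end CatOperad

theorem theoremB1 (k : Type u) [Field k] :
    -- `ℍ` is binary quadratic
    IsBinaryQuadratic.{u} (hyperoperad k) ∧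
    -- the category of `ℍ`-algebras is isomorphic to the category of Markl operads
    ∃ (Φ : COperad.Algebra.{u, v} (hyperoperad k) ⥤ MarklOperad.{v} k)
      (Ψ : MarklOperad.{v} k ⥤ COperad.Algebra.{u, v} (hyperoperad k)),
      Φ ⋙ Ψ = 𝟭 _ ∧ Ψ ⋙ Φ = 𝟭 _ ∧
      -- the isomorphism is the identity on underlying collections and their morphisms,
      Φ ⋙ MarklOperad.forget k = COperad.Algebra.forget (hyperoperad k) ∧
      -- and the operations `∘ᵢ` are given by the action of the classes of `*ᵢ`
      ∀ A : COperad.Algebra.{u, v} (hyperoperad k), ∃ S : MarklStr A.obj, Φ.obj A = ⟨A.obj, S⟩ ∧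
        ∀ {n m : ℕ} (i : Fin n) (x : A.obj.obj ⟨n⟩) (y : A.obj.obj ⟨m⟩),
          S.comp i x y = A.eval (starH k i) (pairArg A.obj x y) := by
  -- `toMarkl` keeps the underlying functor and the underlying transformations, and its `∘ᵢ` are by
  -- definition the values of `[*ᵢ]` on pairs, so the remaining clauses hold by `rfl`.
  refine ⟨hyperoperad_isBinaryQuadratic k, toMarkl k, ofMarkl k, toMarkl_ofMarkl k,
    ofMarkl_toMarkl k, rfl, fun A => ⟨A.marklStr, rfl, fun _ _ _ => rfl⟩⟩
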